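/- Let $d\ge 1$ and let $K$ be a complex-valued kernel on $\{(x,y)\in\mathbb{R}^d\times\mathbb{R}^d:x\neq y\}$ that is a non-degenerate Calderón–Zygmund kernel, i.e. at least one of the following holds: 1. there are a constant $c_K$ and a non-decreasing $\omega:[0,1)\to[0,\infty)$ with $\omega(t)\to0$ as $t\to0$ such that $|K(x,y)|\le c_K|x-y|^{-d}$ for all $x\ne y$ and $$|K(x,y)-K(x',y)|+|K(y,x)-K(y,x')|\le \frac{1}{|x-y|^{d}}\,\omega\Big(\frac{|x-x'|}{|x-y|}\Big)\quad\text{whenever }|x-x'|<\tfrac12|x-y|,$$ and there is $c_0>0$ such that for every $y\in\mathbb{R}^d$ and $r>0$ there exists $x\notin B(y,r)$ with $|K(x,y)|\ge \frac{1}{c_0r^d}$; 2. $K(x,y)=\Omega(x-y)/|x-y|^d$ for $x\neq y$, where $\Omega(tx)=\Omega(x)$ for all $t>0$, $x\in\mathbb{R}^d$, and $\Omega\in L^1(S^{d-1})\setminus\{0\}$. Let $1<q<p<\infty$, $r=\frac{pq}{p-q}\in(1,\infty)$, $q'=\frac{q}{q-1}$ and $\kappa>0$. Then there is a constant $C$,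 depending only on $d,p,q,\kappa$ and $K$, such that the following holds for every $b\in L^1_{\mathrm{loc}}(\mathbb{R}^d)$ (complex-valued) and every $\Theta\ge0$. Suppose that $$\sum_{i=1}^N\Big|\iint (b(x)-b(y))K(x,y)f_i(y)g_i(x)\,dy\,dx\Big|\le\Theta\,\Big\|\sum_{i=1}^N\|f_i\|_\infty 1_{Q_i}\Big\|_{L^p}\Big\|\sum_{i=1}^N\|g_i\|_\infty 1_{\tilde Q_i}\Big\|_{L^{q'}}$$ for all $N$, all axis-parallel cubes $Q_i,\tilde Q_i\subset\mathbb{R}^d$ with $\operatorname{diam}(Q_i)=\operatorname{diam}(\tilde Q_i)$ and $\operatorname{dist}(Q_i,\tilde Q_i)\ge\kappa\operatorname{diam}(Q_i)$, and all complex-valued $f_i,g_i\in L^\infty(\mathbb{R}^d)$ vanishing a.e. outside $Q_i$ and $\tilde Q_i$, respectively $(i=1,\dots,N)$. Then $b=a+c$ almost everywhere for some $a\in L^r(\mathbb{R}^d)$ and some constant $c\in\mathbb{C}$, where $\|a\|_{L^r}\le C\,\Theta$. -/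

import Mathlib

open MeasureTheory Filter Topology
open scoped NNReal ENNReal

namespace CommutatorLpLq

/-- `ω : [0,1) → [0,∞)` is an increasing (i.e. non-decreasing) modulus of continuity with
`ω(t) → 0` as `t → 0`.  Values of `ω` outside `[0,1)` are irrelevant. -/
structure IsVanishingModulus (ω : ℝ → ℝ) : Prop where
  nonneg : ∀ t ∈ Set.Ico (0 : ℝ) 1, 0 ≤ ω t
  mono : MonotoneOn ω (Set.Ico (0 : ℝ) 1)
  tendsto_zero : Tendsto ω (𝓝[>] 0) (𝓝 0)

/-- The size and smoothness conditions of a (two-variable, complex-valued)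
`ω`-Calderón–Zygmund kernel on `ℝ^d`, with size constant `cK`. The values of `K` on the
diagonal are irrelevant. -/
structure IsOmegaCZKernel {d : ℕ} (ω : ℝ → ℝ) (cK : ℝ)
    (K : EuclideanSpace ℝ (Fin d) → EuclideanSpace ℝ (Fin d) → ℂ) : Prop where
  size : ∀ x y, x ≠ y → ‖K x y‖ ≤ cK / ‖x - y‖ ^ d
  smooth : ∀ x x' y, ‖x - x'‖ < 1 / 2 * ‖x - y‖ →
    ‖K x y - K x' y‖ + ‖K y x - K y x'‖ ≤ 1 / ‖x - y‖ ^ d * ω (‖x - x'‖ / ‖x - y‖)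

/-- Non-degenerate two-variable Calderón–Zygmund kernels: uniformly over all positions `y` and
all length-scales `r`, the kernel takes somewhere outside `B(y,r)` a value of size at least
`1 / (c₀ r^d)`. -/
def IsNondegenerateVariableKernel {d : ℕ}
    (K : EuclideanSpace ℝ (Fin d) → EuclideanSpace ℝ (Fin d) → ℂ) : Prop :=
  (∃ (ω : ℝ → ℝ) (cK : ℝ), IsVanishingModulus ω ∧ IsOmegaCZKernel ω cK K) ∧
  ∃ c₀ : ℝ, 0 < c₀ ∧ ∀ (y : EuclideanSpace ℝ (Fin d)) (r : ℝ), 0 < r →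
    ∃ x, x ∉ Metric.ball y r ∧ 1 / (c₀ * r ^ d) ≤ ‖K x y‖

/-- Non-degenerate rough homogeneous kernels `K(x,y) = Ω(x-y) / |x-y|^d`, where `Ω` is positively
homogeneous of degree `0` and its restriction to the unit sphere is an integrable function
(with respect to the surface measure) that is not almost everywhere zero. -/
def IsNondegenerateRoughKernel {d : ℕ}
    (K : EuclideanSpace ℝ (Fin d) → EuclideanSpace ℝ (Fin d) → ℂ) : Prop :=
  ∃ Ω : EuclideanSpace ℝ (Fin d) → ℂ,
    (∀ (t : ℝ) (x : EuclideanSpace ℝ (Fin d)), 0 < t → Ω (t • x) = Ω x) ∧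
    Integrable (fun θ : Metric.sphere (0 : EuclideanSpace ℝ (Fin d)) 1 => Ω θ)
      (volume : Measure (EuclideanSpace ℝ (Fin d))).toSphere ∧
    ¬ (∀ᵐ θ : Metric.sphere (0 : EuclideanSpace ℝ (Fin d)) 1
        ∂(volume : Measure (EuclideanSpace ℝ (Fin d))).toSphere, Ω θ = 0) ∧
    ∀ x y, x ≠ y → K x y = Ω (x - y) / ((‖x - y‖ ^ d : ℝ) : ℂ)

/-- Non-degenerate Calderón–Zygmund kernels: at least one of the two cases holds. -/
def IsNondegenerateCZKernel {d : ℕ}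
    (K : EuclideanSpace ℝ (Fin d) → EuclideanSpace ℝ (Fin d) → ℂ) : Prop :=
  IsNondegenerateVariableKernel K ∨ IsNondegenerateRoughKernel K

/-- The axis-parallel (half-open) cube with lower corner `u` and side length `ℓ`. -/
def cube {d : ℕ} (u : EuclideanSpace ℝ (Fin d)) (ℓ : ℝ) : Set (EuclideanSpace ℝ (Fin d)) :=
  {x | ∀ j, x j ∈ Set.Ico (u j) (u j + ℓ)}

/-- `f ∈ L^∞(Q)`, i.e. `f ∈ L^∞(ℝ^d)` and `f = 1_Q f` (almost everywhere). -/
def MemLinftyOn {d : ℕ} (f : EuclideanSpace ℝ (Fin d) → ℂ)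
    (Q : Set (EuclideanSpace ℝ (Fin d))) : Prop :=
  MemLp f ∞ volume ∧ ∀ᵐ x, x ∉ Q → f x = 0

/-- The off-support bilinear form of the commutator,
`⟨[b,T]f, g⟩ = ∬ (b(x) - b(y)) K(x,y) f(y) g(x) dy dx`. -/
noncomputable def commutatorForm {d : ℕ}
    (K : EuclideanSpace ℝ (Fin d) → EuclideanSpace ℝ (Fin d) → ℂ)
    (b f g : EuclideanSpace ℝ (Fin d) → ℂ) : ℂ :=
  ∫ x, ∫ y, (b x - b y) * K x y * f y * g x

/-- The summed off-support weak `L^p → L^q` bound for `[b,T]` with constant `Θ`, tested on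
finitely many pairs of cubes `Q_i`, `Q̃_i` of equal size with `dist(Q_i, Q̃_i) ≥ κ diam(Q_i)`. -/
def WeakCommutatorBound {d : ℕ}
    (K : EuclideanSpace ℝ (Fin d) → EuclideanSpace ℝ (Fin d) → ℂ)
    (b : EuclideanSpace ℝ (Fin d) → ℂ) (p q κ : ℝ) (Θ : ℝ≥0) : Prop :=
  ∀ (N : ℕ) (u v : Fin N → EuclideanSpace ℝ (Fin d)) (ℓ : Fin N → ℝ)
    (f g : Fin N → EuclideanSpace ℝ (Fin d) → ℂ),
    (∀ i, 0 < ℓ i) →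
    (∀ i, ∀ x ∈ cube (u i) (ℓ i), ∀ y ∈ cube (v i) (ℓ i),
      κ * Metric.diam (cube (u i) (ℓ i)) ≤ dist x y) →
    (∀ i, MemLinftyOn (f i) (cube (u i) (ℓ i))) →
    (∀ i, MemLinftyOn (g i) (cube (v i) (ℓ i))) →
    ∑ i, ‖commutatorForm K b (f i) (g i)‖ₑ ≤
      (Θ : ℝ≥0∞) *
        eLpNorm (fun x => ∑ i, (cube (u i) (ℓ i)).indicator
          (fun _ => eLpNorm (f i) ∞ volume) x) (ENNReal.ofReal p) volume *
        eLpNorm (fun x => ∑ i, (cube (v i) (ℓ i)).indicator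
          (fun _ => eLpNorm (g i) ∞ volume) x) (ENNReal.ofReal (q / (q - 1))) volume

end CommutatorLpLq

namespace CommutatorLpLq

/-! ### Axis-parallel cubes: measurability, volume, diameter. -/

section Cubes

variable {d : ℕ}

/-! The testing hypothesis is converted into a bound for mean oscillations of `b`, and the
oscillations are reassembled into an `L^r` norm by a dyadic stopping argument.

Kernels. Non-degeneracy gives every cube `Q` a partner `Q̃` of the same size, at a distance
comparable to the side and as separated as desired, such that on `Q̃ × Q` the kernel is close to a
constant `k₀` with `|k₀||Q|` bounded below (`HasPartnerCubes`). Smooth kernels get this from the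
modulus of continuity far from the diagonal, rough ones from homogeneity and a Lebesgue point of
`Ω(z)/|z|^d`.

One cube. If `K` were equal to `k₀`, the form with `β = b - b_Q` would be `k₀(∫βg ∫f - ∫g ∫βf)`.
Testing with `1` and with conjugate signs of `β` then recovers `∫_Q |β|`, and the error from `K -
k₀` is absorbed (`IsAlmostConstantOn.exists_osc_le`).

Many cubes. Attaching weights `μ_i` to `f_i` and `ν_i` to `g_i` gives `Σ μ_i ν_i osc(b, Q_i) ≲ Θ ‖Σ
μ_i 1_{Q_i}‖_p ‖Σ ν_i 1_{Q_i}‖_{q'}` (`HasPartnerCubes.exists_sum_osc_le`). Returning from `Q̃_i` to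
`Q_i` in the last norm is dual to the boundedness of a maximal operator.

Stopping. On a fixed cube let `f = b - b_Q`, and let `F` be its maximal function over finitely many
dyadic generations. Stopping at geometric heights `w` yields `∫F^r ≲ Σ w^{r-1} osc(b, P)` over
stopping cubes `P`, while `Σ w^α 1_P ≲ F^α`. Since `1/p + 1/q' = 1 - 1/r`, the weight `w^{r-1}`
splits as `w^{r/p} w^{r/q'}`, and the previous bound gives `Y ≲ Θ Y^{1-1/r}` for `Y = ∫F^r`. The
family is finite, so `Y < ∞` and `Y^{1/r} ≲ Θ`. Lebesgue differentiation and Fatou turn this into a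
uniform `L^r` bound for `b - b_Q` on all cubes, and exhausting the space by cubes produces the
constant `c`. -/

lemma cube_eq_preimage (u : EuclideanSpace ℝ (Fin d)) (ℓ : ℝ) :
    cube u ℓ = (WithLp.ofLp : EuclideanSpace ℝ (Fin d) → Fin d → ℝ) ⁻¹'
      Set.pi Set.univ (fun j => Set.Ico (u j) (u j + ℓ)) := by
  ext x; simp [cube]

lemma measurableSet_cube (u : EuclideanSpace ℝ (Fin d)) (ℓ : ℝ) : MeasurableSet (cube u ℓ) := by
  rw [cube_eq_preimage]
  exact (PiLp.volume_preserving_ofLp (Fin d)).measurable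
    (MeasurableSet.univ_pi fun _ => measurableSet_Ico)

lemma volume_cube (u : EuclideanSpace ℝ (Fin d)) (ℓ : ℝ) :
    volume (cube u ℓ) = ENNReal.ofReal ℓ ^ d := by
  rw [cube_eq_preimage, (PiLp.volume_preserving_ofLp (Fin d)).measure_preimage
    (MeasurableSet.univ_pi fun _ => measurableSet_Ico).nullMeasurableSet, Real.volume_pi_Ico]
  simp

lemma volume_cube_ne_top (u : EuclideanSpace ℝ (Fin d)) (ℓ : ℝ) : volume (cube u ℓ) ≠ ∞ := by
  rw [volume_cube]; finiteness

lemma volume_cube_ne_zero (u : EuclideanSpace ℝ (Fin d)) {ℓ : ℝ} (hℓ : 0 < ℓ) :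
    volume (cube u ℓ) ≠ 0 := by
  rw [volume_cube]; simp [hℓ]

lemma corner_mem_cube (u : EuclideanSpace ℝ (Fin d)) {ℓ : ℝ} (hℓ : 0 < ℓ) : u ∈ cube u ℓ :=
  fun j => ⟨le_rfl, by linarith⟩

lemma norm_le_sqrt_mul {x : EuclideanSpace ℝ (Fin d)} {ℓ : ℝ} (hℓ : 0 ≤ ℓ)
    (h : ∀ j, |x j| ≤ ℓ) : ‖x‖ ≤ √d * ℓ := by
  rw [EuclideanSpace.norm_eq]
  refine Real.sqrt_le_iff.2 ⟨by positivity, ?_⟩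
  calc ∑ i, ‖x i‖ ^ 2 ≤ ∑ _i : Fin d, ℓ ^ 2 := by
        gcongr with i; exact h i
    _ = (√d * ℓ) ^ 2 := by
        rw [mul_pow, Real.sq_sqrt (by positivity)]; simp

lemma norm_sub_le_of_mem_cube {u x y : EuclideanSpace ℝ (Fin d)} {ℓ : ℝ}
    (hx : x ∈ cube u ℓ) (hy : y ∈ cube u ℓ) (hℓ : 0 ≤ ℓ) : ‖x - y‖ ≤ √d * ℓ := by
  refine norm_le_sqrt_mul hℓ fun j => ?_
  have h1 := hx j
  have h2 := hy j
  simp only [Set.mem_Ico, PiLp.sub_apply, abs_le] at *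
  constructor <;> linarith

lemma diam_cube_le (u : EuclideanSpace ℝ (Fin d)) {ℓ : ℝ} (hℓ : 0 ≤ ℓ) :
    Metric.diam (cube u ℓ) ≤ √d * ℓ :=
  Metric.diam_le_of_forall_dist_le (by positivity) fun x hx y hy => by
    rw [dist_eq_norm]; exact norm_sub_le_of_mem_cube hx hy hℓ

lemma cube_subset_closedBall (u : EuclideanSpace ℝ (Fin d)) {ℓ : ℝ} (hℓ : 0 < ℓ) :
    cube u ℓ ⊆ Metric.closedBall u (√d * ℓ) := fun x hx => by
  rw [Metric.mem_closedBall, dist_eq_norm]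
  exact norm_sub_le_of_mem_cube hx (corner_mem_cube u hℓ) hℓ.le

end Cubes

/-- On well separated cubes, `K` is a small perturbation of the constant `k₀` in the mixed
`L^∞ L^1` sense, in either order of the variables. -/
structure IsAlmostConstantOn {d : ℕ}
    (K : EuclideanSpace ℝ (Fin d) → EuclideanSpace ℝ (Fin d) → ℂ) (k₀ : ℂ)
    (u v : EuclideanSpace ℝ (Fin d)) (ℓ : ℝ) : Prop where
  aestronglyMeasurable : AEStronglyMeasurable (Function.uncurry K)
    ((volume.restrict (cube v ℓ)).prod (volume.restrict (cube u ℓ)))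
  left : ∀ y ∈ cube u ℓ, ∫⁻ x in cube v ℓ, ‖K x y - k₀‖ₑ ≤ ‖k₀‖ₑ * ENNReal.ofReal ℓ ^ d / 6
  right : ∀ x ∈ cube v ℓ, ∫⁻ y in cube u ℓ, ‖K x y - k₀‖ₑ ≤ ‖k₀‖ₑ * ENNReal.ofReal ℓ ^ d / 6

/-- Every cube has a partner cube at a comparable distance such that `K` is almost constant, and
non-degenerate, on the product. -/
def HasPartnerCubes {d : ℕ}
    (K : EuclideanSpace ℝ (Fin d) → EuclideanSpace ℝ (Fin d) → ℂ) : Prop :=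
  ∀ κ : ℝ, ∃ (δ R : ℝ), 0 < δ ∧ 0 ≤ R ∧
    ∀ (u : EuclideanSpace ℝ (Fin d)) (ℓ : ℝ), 0 < ℓ → ∃ (v : EuclideanSpace ℝ (Fin d)) (k₀ : ℂ),
      (∀ x ∈ cube u ℓ, ∀ y ∈ cube v ℓ, κ * ℓ ≤ dist x y) ∧ dist u v ≤ R * ℓ ∧
      δ ≤ ‖k₀‖ * ℓ ^ d ∧ IsAlmostConstantOn K k₀ u v ℓ

/-! ### Partner cubes for smooth two-variable kernels. -/

section VariableKernel

variable {d : ℕ} {K : EuclideanSpace ℝ (Fin d) → EuclideanSpace ℝ (Fin d) → ℂ} {ω : ℝ → ℝ} {cK : ℝ}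

/-- One variable is moved at a time. After the first move the points are still `D / 2` apart, so
each displacement has relative size at most `t`; halving the distance costs the factor `2 ^ d`. -/
lemma IsOmegaCZKernel.norm_sub_le (hω : IsVanishingModulus ω) (hK : IsOmegaCZKernel ω cK K)
    {x x' y y' : EuclideanSpace ℝ (Fin d)} {D t : ℝ} (hD : 0 < D) (hDxy : D ≤ ‖x - y‖) (ht : 0 < t)
    (ht' : t < 1 / 2) (hx : ‖x - x'‖ ≤ t * D / 2) (hy : ‖y - y'‖ ≤ t * D / 2) :
    ‖K x' y' - K x y‖ ≤ 2 * (2 ^ d / D ^ d * ω t) := by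
  have hy2 : D / 2 ≤ ‖x - y'‖ := by
    have : ‖x - y‖ ≤ ‖x - y'‖ + ‖y - y'‖ := by
      rw [← norm_sub_rev y' y]
      exact norm_sub_le_norm_sub_add_norm_sub x y' y
    nlinarith
  have hωt : 0 ≤ ω t := hω.nonneg t ⟨ht.le, by linarith⟩
  have key : ∀ s E : ℝ, 0 ≤ s → s ≤ t * D / 2 → D / 2 ≤ E → 1 / E ^ d * ω (s / E) ≤
      2 ^ d / D ^ d * ω t := by
    intro s E hs0 hs hE
    have hE0 : 0 < E := by linarith
    have h1 : s / E ≤ t := by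
      rw [div_le_iff₀ hE0]; nlinarith
    have h2 : ω (s / E) ≤ ω t :=
      hω.mono ⟨by positivity, by linarith⟩ ⟨ht.le, by linarith⟩ h1
    have h3 : 1 / E ^ d ≤ 2 ^ d / D ^ d := by
      rw [← div_pow, ← one_div_pow]
      refine pow_le_pow_left₀ (by positivity) ?_ d
      rw [div_le_div_iff₀ hE0 hD]; linarith
    exact mul_le_mul h3 h2 (hω.nonneg _ ⟨by positivity, by linarith⟩) (by positivity)
  have h1 := hK.smooth x x' y' (by nlinarith)
  have h2 := hK.smooth y y' x (by rw [norm_sub_rev y x]; nlinarith)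
  have h3 := key ‖x - x'‖ ‖x - y'‖ (norm_nonneg _) hx hy2
  have h4 := key ‖y - y'‖ ‖y - x‖ (norm_nonneg _) hy (by rw [norm_sub_rev]; linarith)
  have h5 : ‖K x' y' - K x y‖ ≤ ‖K x y' - K x' y'‖ + ‖K x y - K x y'‖ := by
    rw [norm_sub_rev (K x y'), norm_sub_rev (K x y)]
    exact norm_sub_le_norm_sub_add_norm_sub _ _ _
  have h6 := norm_nonneg (K y' x - K y' x')
  have h7 := norm_nonneg (K y x - K y' x)
  linarith

lemma IsVanishingModulus.exists_lt (hω : IsVanishingModulus ω) {η : ℝ} (hη : 0 < η) :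
    ∃ t, 0 < t ∧ t < 1 / 2 ∧ ω t < η := by
  have h1 := hω.tendsto_zero.eventually (gt_mem_nhds hη)
  have h2 : ∀ᶠ t in 𝓝[>] (0 : ℝ), t ∈ Set.Ioo (0 : ℝ) (1 / 2) :=
    Ioo_mem_nhdsGT (by norm_num)
  obtain ⟨t, h, h'⟩ := (h1.and h2).exists
  exact ⟨t, h'.1, h'.2, h⟩

/-- Continuity off the diagonal supplies the joint measurability of `K` on products of separated
cubes. -/
lemma IsOmegaCZKernel.continuousAt (hω : IsVanishingModulus ω) (hK : IsOmegaCZKernel ω cK K)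
    {z : EuclideanSpace ℝ (Fin d) × EuclideanSpace ℝ (Fin d)} (hz : z.1 ≠ z.2) :
    ContinuousAt (Function.uncurry K) z := by
  obtain ⟨x, y⟩ := z
  have hD : 0 < ‖x - y‖ := norm_pos_iff.2 (sub_ne_zero.2 hz)
  rw [Metric.continuousAt_iff]
  intro ε hε
  obtain ⟨t, ht, ht', hωt⟩ := hω.exists_lt
    (show 0 < ε / (2 * (2 ^ d / ‖x - y‖ ^ d)) by positivity)
  refine ⟨t * ‖x - y‖ / 2, by positivity, ?_⟩
  rintro ⟨x', y'⟩ h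
  rw [Prod.dist_eq, max_lt_iff] at h
  simp only [dist_eq_norm, Function.uncurry] at h ⊢
  rw [norm_sub_rev x', norm_sub_rev y'] at h
  have := hK.norm_sub_le hω hD le_rfl ht ht' h.1.le h.2.le
  rw [lt_div_iff₀ (by positivity)] at hωt
  nlinarith

/-- The partner is centred at a point `v`, at distance at least `A * ℓ` from `u`, where `K v u` is
large. For `A` large the cubes are small relative to their distance, and the oscillation of `K` is
at most a sixth of `‖K v u‖`. -/
theorem IsNondegenerateVariableKernel.hasPartnerCubes (hd : 0 < d)
    (h : IsNondegenerateVariableKernel K) : HasPartnerCubes K := by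
  obtain ⟨⟨ω, cK, hω, hK⟩, c₀, hc₀, hnd⟩ := h
  intro κ
  obtain ⟨t, ht, ht', hωt⟩ := hω.exists_lt
    (show 0 < 1 / 6 / (2 * 2 ^ d * c₀) by positivity)
  -- The first term makes a cube diameter at most `t * (A * ℓ) / 2`, the second gives the
  -- separation, and the third pays for the two cube diameters in the triangle inequality.
  set A : ℝ := 2 * √d / t + |κ| + 2 * √d with hA
  have hd' : (0 : ℝ) < √d := Real.sqrt_pos.2 (by exact_mod_cast hd)
  have hA0 : 0 < A := by positivity
  have htA : √d ≤ t * A / 2 := by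
    have : t * (2 * √d / t) = 2 * √d := by field_simp
    have : t * A = 2 * √d + t * (|κ| + 2 * √d) := by rw [hA]; linear_combination this
    nlinarith [mul_nonneg ht.le (by positivity : 0 ≤ |κ| + 2 * √d)]
  refine ⟨1 / (c₀ * A ^ d), max 1 (cK * c₀) * A, by positivity, by positivity, fun u ℓ hℓ => ?_⟩
  obtain ⟨v, hv, hKv⟩ := hnd u (A * ℓ) (by positivity)
  have hD : A * ℓ ≤ ‖v - u‖ := by
    simpa [dist_eq_norm] using hv
  have hD0 : 0 < A * ℓ := by positivity
  have hvu : v ≠ u := by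
    rintro rfl
    simp at hD; linarith
  have hAC : ∀ x ∈ cube v ℓ, ∀ y ∈ cube u ℓ, ‖K x y - K v u‖ ≤ ‖K v u‖ / 6 := by
    intro x hx y hy
    have h1 : √d * ℓ ≤ t * (A * ℓ) / 2 := by nlinarith
    refine (hK.norm_sub_le hω hD0 hD ht ht'
      ((norm_sub_le_of_mem_cube (corner_mem_cube v hℓ) hx hℓ.le).trans h1)
      ((norm_sub_le_of_mem_cube (corner_mem_cube u hℓ) hy hℓ.le).trans h1)).trans ?_
    calc 2 * (2 ^ d / (A * ℓ) ^ d * ω t)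
        ≤ 2 * (2 ^ d / (A * ℓ) ^ d * (1 / 6 / (2 * 2 ^ d * c₀))) := by gcongr
      _ = 1 / (c₀ * (A * ℓ) ^ d) / 6 := by field_simp
      _ ≤ _ := by gcongr
  have hbd : ∀ x ∈ cube v ℓ, ∀ y ∈ cube u ℓ, ‖K x y - K v u‖ₑ ≤ ‖K v u‖ₑ / 6 := by
    intro x hx y hy
    have := ENNReal.ofReal_le_ofReal (hAC x hx y hy)
    rwa [ofReal_norm, ENNReal.ofReal_div_of_pos (by norm_num), ofReal_norm,
      ENNReal.ofReal_ofNat] at this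
  have hsep : ∀ x ∈ cube u ℓ, ∀ y ∈ cube v ℓ, |κ| * ℓ + ℓ * (2 * √d / t) ≤ dist x y := by
    intro x hx y hy
    have h1 := norm_sub_le_of_mem_cube (corner_mem_cube v hℓ) hy hℓ.le
    have h2 := norm_sub_le_of_mem_cube hx (corner_mem_cube u hℓ) hℓ.le
    have h3 : ‖v - u‖ ≤ ‖v - y‖ + ‖x - y‖ + ‖x - u‖ := by
      have : v - u = (v - y) - (x - y) + (x - u) := by abel
      rw [this]
      exact (norm_add_le _ _).trans (by gcongr; exact norm_sub_le _ _)
    rw [dist_eq_norm]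
    rw [hA] at hD
    linarith
  refine ⟨v, K v u, fun x hx y hy => ?_, ?_, ?_, ?_, ?_, ?_⟩
  · have := hsep x hx y hy
    have h2 := le_abs_self κ
    have : 0 ≤ ℓ * (2 * √d / t) := by positivity
    nlinarith
  · rw [dist_comm, dist_eq_norm]
    -- A partner too far away would violate the size bound, which forces `‖v - u‖ ^ d ≤ cK * c₀ * (A
    -- * ℓ) ^ d`. No `d`-th root is needed because `M ≤ M ^ d` for `M ≥ 1`.
    by_contra! hcon
    have h1 := hKv.trans (hK.size v u hvu)
    have hn : 0 < ‖v - u‖ := by linarith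
    rw [div_le_div_iff₀ (by positivity) (by positivity)] at h1
    set M := max 1 (cK * c₀)
    have hM1 : 1 ≤ M := le_max_left _ _
    have h2 : (M * A * ℓ) ^ d < ‖v - u‖ ^ d := by gcongr
    have h3 : M * (A * ℓ) ^ d ≤ (M * A * ℓ) ^ d := by
      rw [mul_assoc, mul_pow M]
      gcongr
      exact le_self_pow₀ hM1 hd.ne'
    have h4 : cK * c₀ * (A * ℓ) ^ d ≤ M * (A * ℓ) ^ d := by
      gcongr; exact le_max_right _ _
    linarith
  · calc 1 / (c₀ * A ^ d) = 1 / (c₀ * (A * ℓ) ^ d) * ℓ ^ d := by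
          rw [mul_pow]; field_simp
      _ ≤ _ := by gcongr
  · rw [Measure.prod_restrict]
    refine ContinuousOn.aestronglyMeasurable (fun z hz => ?_)
      ((measurableSet_cube _ _).prod (measurableSet_cube _ _))
    refine (hK.continuousAt hω ?_).continuousWithinAt
    intro hne
    have := hsep z.2 hz.2 z.1 hz.1
    rw [hne, dist_self] at this
    have : 0 < ℓ * (2 * √d / t) := by positivity
    have := mul_nonneg (abs_nonneg κ) hℓ.le
    linarith
  · intro y hy
    refine (setLIntegral_mono' (measurableSet_cube v ℓ) fun x hx => hbd x hx y hy).trans ?_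
    rw [setLIntegral_const, volume_cube, ENNReal.mul_div_right_comm]
  · intro x hx
    refine (setLIntegral_mono' (measurableSet_cube u ℓ) fun y hy => hbd x hx y hy).trans ?_
    rw [setLIntegral_const, volume_cube, ENNReal.mul_div_right_comm]

end VariableKernel

/-! ### Partner cubes for rough homogeneous kernels. -/

section RoughKernel

variable {d : ℕ}

open Classical in
/-- The restriction of the homogeneous function `Ω(z) / |z|^d` to the annulus `1 < |z| < 2`. -/
noncomputable def annularPart (Ω : EuclideanSpace ℝ (Fin d) → ℂ) (z : EuclideanSpace ℝ (Fin d)) :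
    ℂ :=
  if 1 < ‖z‖ ∧ ‖z‖ < 2 then Ω z / ((‖z‖ ^ d : ℝ) : ℂ) else 0

open Classical in
/-- The radial factor of `annularPart`. -/
noncomputable def annularRadialPart (d : ℕ) (r : Set.Ioi (0 : ℝ)) : ℂ :=
  if 1 < r.1 ∧ r.1 < 2 then 1 / ((r.1 ^ d : ℝ) : ℂ) else 0

lemma integrable_annularRadialPart (d n : ℕ) :
    Integrable (annularRadialPart d) (Measure.volumeIoiPow n) := by
  have hfin : Measure.volumeIoiPow n (Set.Iio ⟨2, by norm_num⟩) ≠ ∞ := by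
    rw [Measure.volumeIoiPow_apply_Iio]; exact ENNReal.ofReal_ne_top
  have hg : Integrable ((Set.Iio (⟨2, by norm_num⟩ : Set.Ioi (0 : ℝ))).indicator
      (fun _ => (1 : ℝ))) (Measure.volumeIoiPow n) :=
    (integrable_indicator_iff measurableSet_Iio).2 (integrableOn_const hfin)
  refine hg.mono' ?_ (Eventually.of_forall fun r => ?_)
  · refine Measurable.aestronglyMeasurable ?_
    unfold annularRadialPart
    refine Measurable.ite ?_ (by fun_prop) measurable_const
    exact (measurableSet_lt measurable_const measurable_subtype_coe).inter
      (measurableSet_lt measurable_subtype_coe measurable_const)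
  · unfold annularRadialPart
    split_ifs with h
    · rw [Set.indicator_of_mem (show r ∈ Set.Iio (⟨2, by norm_num⟩ : Set.Ioi (0 : ℝ)) from h.2)]
      rw [norm_div, norm_one, Complex.norm_real, Real.norm_of_nonneg (by have := r.2.out; positivity)]
      exact div_le_one_of_le₀ (one_le_pow₀ h.1.le) (by have := r.2.out; positivity)
    · rw [norm_zero]; exact Set.indicator_nonneg (fun _ _ => zero_le_one) _

/-- The radial factor is nonzero on `[3/2, 2)`, which has positive measure since `Iio 2` is strictly
heavier than `Iio (3/2)`. -/
lemma annularRadialPart_not_ae_zero (d n : ℕ) :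
    ¬ ∀ᵐ r ∂(Measure.volumeIoiPow n), annularRadialPart d r = 0 := by
  intro h
  have h0 : Measure.volumeIoiPow n {r | ¬ annularRadialPart d r = 0} = 0 := h
  have hsub : (Set.Iio (⟨2, by norm_num⟩ : Set.Ioi (0 : ℝ))) ⊆
      Set.Iio ⟨3 / 2, by norm_num⟩ ∪ {r | ¬ annularRadialPart d r = 0} := by
    intro r hr
    by_cases h : r < ⟨3 / 2, by norm_num⟩
    · exact Or.inl h
    · right
      have h1 : 3 / 2 ≤ r.1 := not_lt.1 h
      have h2 : r.1 < 2 := hr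
      have h3 : 0 < r.1 := r.2
      change ¬ annularRadialPart d r = 0
      rw [annularRadialPart, if_pos ⟨by linarith, h2⟩, one_div, inv_eq_zero]
      exact_mod_cast (pow_pos h3 d).ne'
  have := (measure_mono (μ := Measure.volumeIoiPow n) hsub).trans (measure_union_le _ _)
  rw [h0, add_zero, Measure.volumeIoiPow_apply_Iio, Measure.volumeIoiPow_apply_Iio,
    ENNReal.ofReal_le_ofReal_iff (by positivity)] at this
  have h4 : (3 / 2 : ℝ) ^ (n + 1) < 2 ^ (n + 1) := by
    gcongr; norm_num
  have h5 : (3 / 2 : ℝ) ^ (n + 1) / (n + 1) < 2 ^ (n + 1) / (n + 1) := by gcongr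
  exact absurd this (not_le.2 h5)

variable {Ω : EuclideanSpace ℝ (Fin d) → ℂ}

lemma annularPart_eq (hΩ : ∀ (t : ℝ) (x : EuclideanSpace ℝ (Fin d)), 0 < t → Ω (t • x) = Ω x)
    (x : ({0}ᶜ : Set (EuclideanSpace ℝ (Fin d)))) :
    annularPart Ω x = Ω (homeomorphUnitSphereProd (EuclideanSpace ℝ (Fin d)) x).1 *
      annularRadialPart d (homeomorphUnitSphereProd (EuclideanSpace ℝ (Fin d)) x).2 := by
  have hx : (0 : ℝ) < ‖x.1‖ := norm_pos_iff.2 x.2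
  simp only [annularPart, annularRadialPart, homeomorphUnitSphereProd_apply_snd_coe,
    homeomorphUnitSphereProd_apply_fst_coe]
  rw [hΩ _ _ (inv_pos.2 hx)]
  split_ifs <;> simp [div_eq_mul_inv]

/-- In polar coordinates the function is a product of `Ω` on the sphere and an integrable radial
factor. The cut-off to an annulus is what makes the radial factor integrable. -/
lemma integrable_annularPart
    (hΩ : ∀ (t : ℝ) (x : EuclideanSpace ℝ (Fin d)), 0 < t → Ω (t • x) = Ω x)
    (hint : Integrable (fun θ : Metric.sphere (0 : EuclideanSpace ℝ (Fin d)) 1 => Ω θ)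
      (volume : Measure (EuclideanSpace ℝ (Fin d))).toSphere) (hd : 0 < d) :
    Integrable (annularPart Ω) volume := by
  have : Nontrivial (EuclideanSpace ℝ (Fin d)) := by
    have : Nonempty (Fin d) := ⟨⟨0, hd⟩⟩
    infer_instance
  rw [← restrict_compl_singleton (μ := volume) (0 : EuclideanSpace ℝ (Fin d)), ← IntegrableOn,
    integrableOn_iff_comap_subtypeVal (by measurability)]
  have h := (volume : Measure (EuclideanSpace ℝ (Fin d))).measurePreserving_homeomorphUnitSphereProd
  have h2 := (h.integrable_comp_emb (Homeomorph.measurableEmbedding _)).2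
    (hint.mul_prod (integrable_annularRadialPart d _))
  refine h2.congr (Eventually.of_forall fun x => ?_)
  simp only [Function.comp]
  exact (annularPart_eq hΩ x).symm

/-- If the product of the spherical and radial factors has zero integral, one factor vanishes almost
everywhere, and neither does. -/
lemma annularPart_not_ae_zero
    (hΩ : ∀ (t : ℝ) (x : EuclideanSpace ℝ (Fin d)), 0 < t → Ω (t • x) = Ω x)
    (hint : Integrable (fun θ : Metric.sphere (0 : EuclideanSpace ℝ (Fin d)) 1 => Ω θ)
      (volume : Measure (EuclideanSpace ℝ (Fin d))).toSphere)
    (hne : ¬ (∀ᵐ θ : Metric.sphere (0 : EuclideanSpace ℝ (Fin d)) 1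
        ∂(volume : Measure (EuclideanSpace ℝ (Fin d))).toSphere, Ω θ = 0)) :
    ¬ ∀ᵐ z, annularPart Ω z = 0 := by
  intro hz
  have h := (volume : Measure (EuclideanSpace ℝ (Fin d))).measurePreserving_homeomorphUnitSphereProd
  have hz' : ∀ᵐ x : ({0}ᶜ : Set (EuclideanSpace ℝ (Fin d))) ∂((volume : Measure (EuclideanSpace ℝ (Fin d))).comap
      (Subtype.val : ({0}ᶜ : Set (EuclideanSpace ℝ (Fin d))) → _)), annularPart Ω x = 0 := by
    rw [ae_iff] at hz ⊢
    refine (comap_subtype_coe_apply (measurableSet_singleton _).compl volume _).trans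
      (measure_mono_null ?_ hz)
    rintro _ ⟨x, hx, rfl⟩
    exact hx
  have h0 : ∫⁻ x : ({0}ᶜ : Set (EuclideanSpace ℝ (Fin d))), ‖annularPart Ω x‖ₑ ∂((volume : Measure (EuclideanSpace ℝ (Fin d))).comap
      (Subtype.val : ({0}ᶜ : Set (EuclideanSpace ℝ (Fin d))) → _)) = 0 := by
    rw [lintegral_congr_ae (g := 0) (by filter_upwards [hz'] with x hx; simp [hx])]
    simp
  have h1 : ∫⁻ p, ‖Ω p.1‖ₑ * ‖annularRadialPart d p.2‖ₑ
      ∂((volume : Measure (EuclideanSpace ℝ (Fin d))).toSphere.prod (Measure.volumeIoiPow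
        (Module.finrank ℝ (EuclideanSpace ℝ (Fin d)) - 1))) = 0 := by
    rw [← h0, ← h.lintegral_comp_emb (Homeomorph.measurableEmbedding _)]
    refine lintegral_congr fun x => ?_
    rw [annularPart_eq hΩ x, enorm_mul]
  rw [lintegral_prod_mul hint.aestronglyMeasurable.enorm
    (integrable_annularRadialPart d _).aestronglyMeasurable.enorm, mul_eq_zero,
    lintegral_eq_zero_iff' hint.aestronglyMeasurable.enorm,
    lintegral_eq_zero_iff' (integrable_annularRadialPart d _).aestronglyMeasurable.enorm] at h1
  rcases h1 with h1 | h1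
  · exact hne (by filter_upwards [h1] with θ hθ using by simpa using hθ)
  · exact annularRadialPart_not_ae_zero d _ (by filter_upwards [h1] with θ hθ using by simpa using hθ)

/-- The argument goes through a measurable equivalence, since `G` will be built from `Ω`, which is
only a.e. measurable. -/
lemma lintegral_comp_inv_smul (G : EuclideanSpace ℝ (Fin d) → ℝ≥0∞) {s : ℝ} (hs : 0 < s) :
    ∫⁻ x, G (s⁻¹ • x) = ENNReal.ofReal (s ^ d) * ∫⁻ x, G x := by
  have h1 := lintegral_map_equiv (μ := (volume : Measure (EuclideanSpace ℝ (Fin d)))) G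
    (Homeomorph.smulOfNeZero (s⁻¹ : ℝ) (inv_pos.2 hs).ne').toMeasurableEquiv
  have h2 := Measure.map_addHaar_smul (volume : Measure (EuclideanSpace ℝ (Fin d)))
    (inv_pos.2 hs).ne'
  simp only [Homeomorph.toMeasurableEquiv_coe, Homeomorph.smulOfNeZero_apply] at h1
  have h4 : ∫⁻ x, G (s⁻¹ • x) = ∫⁻ x, G x ∂(Measure.map (fun x => s⁻¹ • x) volume) := by
    exact h1.symm
  rw [h4]
  have h5 : Measure.map (fun x : EuclideanSpace ℝ (Fin d) => s⁻¹ • x) volume =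
    ENNReal.ofReal (s ^ d) • volume := by
    have h6 := h2
    rw [finrank_euclideanSpace_fin] at h6
    rw [show (fun x : EuclideanSpace ℝ (Fin d) => s⁻¹ • x) = (s⁻¹ • ·) from rfl, h6]
    congr 2
    rw [inv_pow, inv_inv, abs_of_pos (by positivity)]
  rw [h5, lintegral_smul_measure, smul_eq_mul]

/-- Lebesgue points of the annular part, in quantitative form. -/
lemma exists_lebesgue_point_annularPart (hd : 0 < d)
    (hΩ : ∀ (t : ℝ) (x : EuclideanSpace ℝ (Fin d)), 0 < t → Ω (t • x) = Ω x)
    (hint : Integrable (fun θ : Metric.sphere (0 : EuclideanSpace ℝ (Fin d)) 1 => Ω θ)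
      (volume : Measure (EuclideanSpace ℝ (Fin d))).toSphere)
    (hne : ¬ (∀ᵐ θ : Metric.sphere (0 : EuclideanSpace ℝ (Fin d)) 1
        ∂(volume : Measure (EuclideanSpace ℝ (Fin d))).toSphere, Ω θ = 0))
    {c ρ : ℝ} (hc : 0 < c) (hρ : 0 < ρ) :
    ∃ (z : EuclideanSpace ℝ (Fin d)) (δ : ℝ), 0 < δ ∧ δ < ρ ∧ annularPart Ω z ≠ 0 ∧
      (∀ w ∈ Metric.closedBall z δ, 1 < ‖w‖ ∧ ‖w‖ < 2) ∧
      ∫⁻ w in Metric.closedBall z δ, ‖annularPart Ω w - annularPart Ω z‖ₑ ≤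
        ‖annularPart Ω z‖ₑ * ENNReal.ofReal (c * δ ^ d) := by
  have hI := integrable_annularPart hΩ hint hd
  have hleb := IsUnifLocDoublingMeasure.ae_tendsto_average_norm_sub
    (volume : Measure (EuclideanSpace ℝ (Fin d))) hI.locallyIntegrable 1
  have hfr : ∃ᶠ z in ae (volume : Measure (EuclideanSpace ℝ (Fin d))), annularPart Ω z ≠ 0 :=
    not_eventually.1 (annularPart_not_ae_zero hΩ hint hne)
  obtain ⟨z, hz0, hz⟩ := (hfr.and_eventually hleb).exists
  have hann : 1 < ‖z‖ ∧ ‖z‖ < 2 := by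
    by_contra hcon
    exact hz0 (if_neg hcon)
  have hT := hz (l := 𝓝[>] (0 : ℝ)) (fun _ => z) id tendsto_id (by
    filter_upwards [self_mem_nhdsWithin] with j hj
    have : (0 : ℝ) < j := hj
    simp [this.le])
  set W := volume.real (Metric.closedBall (0 : EuclideanSpace ℝ (Fin d)) 1) with hW
  have hW0 : 0 < W := by
    rw [hW, measureReal_def]
    exact ENNReal.toReal_pos (Metric.measure_closedBall_pos _ _ one_pos).ne'
      measure_closedBall_lt_top.ne
  have hη : 0 < ‖annularPart Ω z‖ * c / W := by
    have := norm_pos_iff.2 hz0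
    positivity
  have hm : 0 < min ρ (min (‖z‖ - 1) (2 - ‖z‖)) := by
    simp [hρ, hann.1, hann.2]
  obtain ⟨δ, hδ, hδ0, hδm⟩ := ((hT.eventually (gt_mem_nhds hη)).and
    (Ioo_mem_nhdsGT hm)).exists
  simp only [lt_min_iff] at hδm
  refine ⟨z, δ, hδ0, hδm.1, hz0, fun w hw => ?_, ?_⟩
  · rw [Metric.mem_closedBall, dist_eq_norm] at hw
    have h1 := abs_norm_sub_norm_le w z
    rw [abs_le] at h1
    constructor <;> linarith [hδm.2.1, hδm.2.2]
  · have hIB : IntegrableOn (fun w => annularPart Ω w - annularPart Ω z)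
        (Metric.closedBall z δ) volume :=
      hI.integrableOn.sub (integrableOn_const measure_closedBall_lt_top.ne)
    rw [← ofReal_norm (annularPart Ω z), ← ENNReal.ofReal_mul (norm_nonneg _),
      ← ofReal_integral_norm_eq_lintegral_enorm hIB]
    refine ENNReal.ofReal_le_ofReal ?_
    rw [setAverage_eq, smul_eq_mul, inv_mul_lt_iff₀ (by
      rw [measureReal_def]
      exact ENNReal.toReal_pos (Metric.measure_closedBall_pos _ _ hδ0).ne'
        measure_closedBall_lt_top.ne)] at hδ
    have hvol : volume.real (Metric.closedBall z δ) = δ ^ d * W := by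
      rw [hW, measureReal_def, Measure.addHaar_closedBall' _ _ hδ0.le, ENNReal.toReal_mul,
        finrank_euclideanSpace_fin, ENNReal.toReal_ofReal (by positivity), measureReal_def]
    simp only [id] at hδ
    rw [hvol] at hδ
    refine hδ.le.trans (le_of_eq ?_)
    field_simp

/-- Homogeneity gives `K x y = s⁻ᵈ k((x - y)/s)` as long as `(x - y)/s` is in the annulus. Taking
the partner at `u + s • z`, with `z` a Lebesgue point of `k` and `s` a large multiple of `ℓ`, places
all these quotients in a small ball around `z`, where `k` is close to `k z` in mean. Only averages
are controlled, hence the mixed-norm form of `IsAlmostConstantOn`. -/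
theorem IsNondegenerateRoughKernel.hasPartnerCubes (hd : 0 < d)
    {K : EuclideanSpace ℝ (Fin d) → EuclideanSpace ℝ (Fin d) → ℂ}
    (h : IsNondegenerateRoughKernel K) : HasPartnerCubes K := by
  obtain ⟨Ω, hΩ, hint, hne, hK⟩ := h
  intro κ
  have hd' : (0 : ℝ) < √d := Real.sqrt_pos.2 (by exact_mod_cast hd)
  -- With `t = √d / δ`, this `c` turns `c * δ ^ d` into `1 / (6 * t ^ d)`, and this `ρ` forces `t ≥
  -- |κ| + 1`. The scale `s = t * ℓ` satisfies `s * δ = √d * ℓ`, so that rescaled differences stay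
  -- in the `δ`-ball.
  obtain ⟨z, δ, hδ, hδρ, hz, hann, hleb⟩ := exists_lebesgue_point_annularPart hd hΩ hint hne
    (c := 1 / (6 * √d ^ d)) (ρ := √d / (|κ| + 1)) (by positivity) (by positivity)
  have hI := integrable_annularPart hΩ hint hd
  set k := annularPart Ω with hk
  set t : ℝ := √d / δ with ht
  have ht0 : 0 < t := by positivity
  have htκ : κ ≤ t := by
    have h1 : |κ| + 1 ≤ t := by
      rw [ht, le_div_iff₀ hδ]
      rw [lt_div_iff₀ (by positivity)] at hδρ
      linarith
    linarith [le_abs_self κ]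
  have hzn := norm_pos_iff.2 hz
  refine ⟨‖k z‖ / t ^ d, t * ‖z‖, by positivity, by positivity, fun u ℓ hℓ => ?_⟩
  set s : ℝ := t * ℓ with hs
  have hs0 : 0 < s := by positivity
  have hmem : ∀ x ∈ cube (u + s • z) ℓ, ∀ y ∈ cube u ℓ, s⁻¹ • (x - y) ∈ Metric.closedBall z δ := by
    intro x hx y hy
    have h1 : ‖(x - y) - s • z‖ ≤ √d * ℓ := by
      have : x - y - s • z = (x - s • z) - y := by abel
      rw [this]
      refine norm_sub_le_of_mem_cube (u := u) (fun j => ?_) hy hℓ.le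
      have := hx j
      simp only [Set.mem_Ico, PiLp.add_apply, PiLp.sub_apply] at this ⊢
      constructor <;> linarith
    rw [Metric.mem_closedBall, dist_eq_norm]
    have h2 : s⁻¹ • (x - y) - z = s⁻¹ • (x - y - s • z) := by
      rw [smul_sub s⁻¹ (x - y), smul_smul, inv_mul_cancel₀ hs0.ne', one_smul]
    rw [h2, norm_smul, norm_inv, Real.norm_of_nonneg hs0.le, inv_mul_le_iff₀ hs0]
    have h3 : s * δ = √d * ℓ := by rw [hs, ht]; field_simp
    rw [h3]; exact h1
  have hKeq : ∀ x ∈ cube (u + s • z) ℓ, ∀ y ∈ cube u ℓ,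
      K x y = ((s ^ d : ℝ) : ℂ)⁻¹ * k (s⁻¹ • (x - y)) := by
    intro x hx y hy
    have h1 := hann _ (hmem x hx y hy)
    have hxy : x ≠ y := by
      rintro rfl
      rw [sub_self, smul_zero, norm_zero] at h1
      linarith [h1.1]
    rw [hK x y hxy, hk, annularPart, if_pos h1, hΩ _ _ (inv_pos.2 hs0), norm_smul, norm_inv,
      Real.norm_of_nonneg hs0.le, mul_pow s⁻¹, inv_pow]
    have : ((s ^ d : ℝ) : ℂ) ≠ 0 := by exact_mod_cast (pow_pos hs0 d).ne'
    rw [Complex.ofReal_mul, Complex.ofReal_inv, div_eq_mul_inv, div_eq_mul_inv, mul_inv, inv_inv]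
    field_simp
  set G : EuclideanSpace ℝ (Fin d) → ℝ≥0∞ :=
    (Metric.closedBall z δ).indicator (fun w => ‖k w - k z‖ₑ) with hG
  have hKG : ∀ x ∈ cube (u + s • z) ℓ, ∀ y ∈ cube u ℓ,
      ‖K x y - ((s ^ d : ℝ) : ℂ)⁻¹ * k z‖ₑ = ENNReal.ofReal (s ^ d)⁻¹ * G (s⁻¹ • (x - y)) := by
    intro x hx y hy
    rw [hKeq x hx y hy, ← mul_sub, enorm_mul, hG, Set.indicator_of_mem (hmem x hx y hy)]
    congr 1
    rw [← ofReal_norm, norm_inv, Complex.norm_real, Real.norm_of_nonneg (by positivity)]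
  have hGint : ENNReal.ofReal (s ^ d)⁻¹ * (ENNReal.ofReal (s ^ d) * ∫⁻ w, G w) ≤
      ‖((s ^ d : ℝ) : ℂ)⁻¹ * k z‖ₑ * ENNReal.ofReal ℓ ^ d / 6 := by
    rw [← mul_assoc, ← ENNReal.ofReal_mul (by positivity), inv_mul_cancel₀ (by positivity),
      ENNReal.ofReal_one, one_mul, hG, lintegral_indicator measurableSet_closedBall]
    refine hleb.trans (le_of_eq ?_)
    rw [← ofReal_norm, ← ofReal_norm, ← ENNReal.ofReal_mul (norm_nonneg _),
      ← ENNReal.ofReal_pow hℓ.le, ← ENNReal.ofReal_mul (norm_nonneg _),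
      ← ENNReal.ofReal_ofNat, ← ENNReal.ofReal_div_of_pos (by norm_num), norm_mul, norm_inv,
      Complex.norm_real, Real.norm_of_nonneg (by positivity), hs, ht, mul_pow,
      div_pow]
    congr 1
    field_simp
  refine ⟨u + s • z, ((s ^ d : ℝ) : ℂ)⁻¹ * k z, ?_, ?_, ?_, ?_, ?_, ?_⟩
  -- The quotient lies outside the unit ball, so `dist y x > s = t * ℓ ≥ κ * ℓ`.
  · intro y hy x hx
    have h1 := (hann _ (hmem x hx y hy)).1
    rw [norm_smul, norm_inv, Real.norm_of_nonneg hs0.le, lt_inv_mul_iff₀ hs0] at h1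
    rw [dist_comm, dist_eq_norm]
    nlinarith
  · rw [dist_eq_norm, sub_add_cancel_left, norm_neg, norm_smul, Real.norm_of_nonneg hs0.le, hs]
    exact le_of_eq (by ring)
  · rw [norm_mul, norm_inv, Complex.norm_real, Real.norm_of_nonneg (by positivity), hs, mul_pow]
    refine le_of_eq ?_
    field_simp
  · have h1 : AEStronglyMeasurable (fun p : EuclideanSpace ℝ (Fin d) × EuclideanSpace ℝ (Fin d) =>
        ((s ^ d : ℝ) : ℂ)⁻¹ * k (s⁻¹ • (p.1 - p.2))) (volume.prod volume) := by
      have h2 : Measure.QuasiMeasurePreserving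
          (fun x : EuclideanSpace ℝ (Fin d) => s⁻¹ • x) volume volume := by
        refine ⟨measurable_const_smul _, ?_⟩
        rw [Measure.map_addHaar_smul _ (inv_pos.2 hs0).ne']
        exact Measure.smul_absolutelyContinuous
      have h3 := hI.aestronglyMeasurable.comp_quasiMeasurePreserving
        (h2.comp (quasiMeasurePreserving_sub volume volume))
      exact h3.const_mul _
    rw [Measure.prod_restrict]
    refine h1.restrict.congr ?_
    filter_upwards [ae_restrict_mem ((measurableSet_cube (u + s • z) ℓ).prod
      (measurableSet_cube u ℓ))] with p hp
    exact (hKeq p.1 hp.1 p.2 hp.2).symm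
  · intro y hy
    rw [setLIntegral_congr_fun (measurableSet_cube _ _) fun x hx => hKG x hx y hy]
    refine le_trans ?_ hGint
    rw [lintegral_const_mul' _ _ ENNReal.ofReal_ne_top, ← lintegral_comp_inv_smul G hs0,
      ← lintegral_sub_right_eq_self (fun x => G (s⁻¹ • x)) y]
    exact mul_le_mul_right (setLIntegral_le_lintegral _ _) _
  · intro x hx
    rw [setLIntegral_congr_fun (measurableSet_cube _ _) fun y hy => hKG x hx y hy]
    refine le_trans ?_ hGint
    rw [lintegral_const_mul' _ _ ENNReal.ofReal_ne_top, ← lintegral_comp_inv_smul G hs0,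
      ← lintegral_sub_left_eq_self (fun x => G (s⁻¹ • x)) x]
    exact mul_le_mul_right (setLIntegral_le_lintegral _ _) _

end RoughKernel

theorem IsNondegenerateCZKernel.hasPartnerCubes {d : ℕ} (hd : 0 < d)
    {K : EuclideanSpace ℝ (Fin d) → EuclideanSpace ℝ (Fin d) → ℂ}
    (h : IsNondegenerateCZKernel K) : HasPartnerCubes K :=
  h.elim (fun h => h.hasPartnerCubes hd) (fun h => h.hasPartnerCubes hd)

/-! ### Mean oscillation on one cube from three tests of the commutator. -/

section SingleCube

variable {d : ℕ}

/-- The (unnormalised) mean oscillation of `b` on `Q`. -/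
noncomputable def osc {X : Type*} [MeasureSpace X] (b : X → ℂ) (Q : Set X) : ℝ≥0∞ :=
  ∫⁻ x in Q, ‖b x - ⨍ y in Q, b y‖ₑ

lemma commutatorForm_sub_const (K : EuclideanSpace ℝ (Fin d) → EuclideanSpace ℝ (Fin d) → ℂ)
    (b f g : EuclideanSpace ℝ (Fin d) → ℂ) (c : ℂ) :
    commutatorForm K (fun x => b x - c) f g = commutatorForm K b f g := by
  simp [commutatorForm]

lemma commutatorForm_eq_setIntegral
    (K : EuclideanSpace ℝ (Fin d) → EuclideanSpace ℝ (Fin d) → ℂ)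
    (b : EuclideanSpace ℝ (Fin d) → ℂ) {f g : EuclideanSpace ℝ (Fin d) → ℂ}
    {Q Q' : Set (EuclideanSpace ℝ (Fin d))} (hf : ∀ y, y ∉ Q → f y = 0)
    (hg : ∀ x, x ∉ Q' → g x = 0) :
    commutatorForm K b f g = ∫ x in Q', ∫ y in Q, (b x - b y) * K x y * f y * g x := by
  rw [commutatorForm, setIntegral_eq_integral_of_forall_compl_eq_zero]
  · congr 1
    ext x
    rw [setIntegral_eq_integral_of_forall_compl_eq_zero]
    intro y hy
    simp [hf y hy]
  · intro x hx
    simp [hg x hx]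

/-- Split `K = k₀ + (K - k₀)`. The constant part factors by Fubini. In the remainder, `|β x - β y| ≤
|β x| + |β y|`, and the variable on which `β` does not depend is integrated first; this is where
both mixed-norm bounds enter. -/
lemma IsAlmostConstantOn.norm_commutatorForm_sub_le
    {K : EuclideanSpace ℝ (Fin d) → EuclideanSpace ℝ (Fin d) → ℂ} {k₀ : ℂ}
    {u v : EuclideanSpace ℝ (Fin d)} {ℓ : ℝ} (hℓ : 0 < ℓ) (h : IsAlmostConstantOn K k₀ u v ℓ)
    {β f g : EuclideanSpace ℝ (Fin d) → ℂ} (hβu : IntegrableOn β (cube u ℓ))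
    (hβv : IntegrableOn β (cube v ℓ))
    (hfm : AEStronglyMeasurable f (volume.restrict (cube u ℓ)))
    (hgm : AEStronglyMeasurable g (volume.restrict (cube v ℓ)))
    (hf1 : ∀ y, ‖f y‖ ≤ 1) (hg1 : ∀ x, ‖g x‖ ≤ 1)
    (hf : ∀ y, y ∉ cube u ℓ → f y = 0) (hg : ∀ x, x ∉ cube v ℓ → g x = 0) :
    ‖commutatorForm K β f g - k₀ * ((∫ x in cube v ℓ, β x * g x) * (∫ y in cube u ℓ, f y) -
      (∫ x in cube v ℓ, g x) * (∫ y in cube u ℓ, β y * f y))‖ ≤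
      ‖k₀‖ * ℓ ^ d / 6 * ((∫ y in cube u ℓ, ‖β y‖) + ∫ x in cube v ℓ, ‖β x‖) := by
  set mu := (volume : Measure (EuclideanSpace ℝ (Fin d))).restrict (cube u ℓ) with hmu
  set mv := (volume : Measure (EuclideanSpace ℝ (Fin d))).restrict (cube v ℓ) with hmv
  have : IsFiniteMeasure mu := ⟨by
    rw [hmu, Measure.restrict_apply_univ]; exact (volume_cube_ne_top _ _).lt_top⟩
  have : IsFiniteMeasure mv := ⟨by
    rw [hmv, Measure.restrict_apply_univ]; exact (volume_cube_ne_top _ _).lt_top⟩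
  have hfi : Integrable f mu := (integrable_const (1 : ℝ)).mono' hfm (Eventually.of_forall hf1)
  have hgi : Integrable g mv := (integrable_const (1 : ℝ)).mono' hgm (Eventually.of_forall hg1)
  have hβf : Integrable (fun y => β y * f y) mu :=
    hβu.mul_bdd hfm (Eventually.of_forall hf1)
  have hβg : Integrable (fun x => β x * g x) mv :=
    hβv.mul_bdd hgm (Eventually.of_forall hg1)
  set G : EuclideanSpace ℝ (Fin d) × EuclideanSpace ℝ (Fin d) → ℂ := fun p =>
    (β p.1 - β p.2) * (K p.1 p.2 - k₀) * f p.2 * g p.1 with hG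
  set H : EuclideanSpace ℝ (Fin d) × EuclideanSpace ℝ (Fin d) → ℂ := fun p =>
    k₀ * ((β p.1 * g p.1) * f p.2 - g p.1 * (β p.2 * f p.2)) with hH
  have hH1 : Integrable (fun p : EuclideanSpace ℝ (Fin d) × EuclideanSpace ℝ (Fin d) =>
      (β p.1 * g p.1) * f p.2) (mv.prod mu) := hβg.mul_prod hfi
  have hH2 : Integrable (fun p : EuclideanSpace ℝ (Fin d) × EuclideanSpace ℝ (Fin d) =>
      g p.1 * (β p.2 * f p.2)) (mv.prod mu) := hgi.mul_prod hβf
  have hHi : Integrable H (mv.prod mu) := (hH1.sub hH2).const_mul k₀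
  have hKm : AEStronglyMeasurable (fun p : EuclideanSpace ℝ (Fin d) × EuclideanSpace ℝ (Fin d) =>
      K p.1 p.2 - k₀) (mv.prod mu) :=
    h.aestronglyMeasurable.sub aestronglyMeasurable_const
  have hβ1 : AEStronglyMeasurable (fun p : EuclideanSpace ℝ (Fin d) × EuclideanSpace ℝ (Fin d) =>
      β p.1) (mv.prod mu) := hβv.aestronglyMeasurable.comp_fst
  have hβ2 : AEStronglyMeasurable (fun p : EuclideanSpace ℝ (Fin d) × EuclideanSpace ℝ (Fin d) =>
      β p.2) (mv.prod mu) := hβu.aestronglyMeasurable.comp_snd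
  have hGm : AEStronglyMeasurable G (mv.prod mu) :=
    (((hβ1.sub hβ2).mul hKm).mul hfm.comp_snd).mul hgm.comp_fst
  set c : ℝ≥0∞ := ‖k₀‖ₑ * ENNReal.ofReal ℓ ^ d / 6 with hc
  have hGle : ∫⁻ p, ‖G p‖ₑ ∂(mv.prod mu) ≤ c * ((∫⁻ y, ‖β y‖ₑ ∂mu) + ∫⁻ x, ‖β x‖ₑ ∂mv) := by
    calc ∫⁻ p, ‖G p‖ₑ ∂(mv.prod mu)
        ≤ ∫⁻ p, (‖β p.2‖ₑ * ‖K p.1 p.2 - k₀‖ₑ + ‖β p.1‖ₑ * ‖K p.1 p.2 - k₀‖ₑ) ∂(mv.prod mu) := by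
          refine lintegral_mono fun p => ?_
          have h1 : ‖f p.2‖ₑ ≤ 1 := by
            rw [← ofReal_norm]; exact ENNReal.ofReal_le_one.2 (hf1 _)
          have h2 : ‖g p.1‖ₑ ≤ 1 := by
            rw [← ofReal_norm]; exact ENNReal.ofReal_le_one.2 (hg1 _)
          have h3 : ‖β p.1 - β p.2‖ₑ ≤ ‖β p.2‖ₑ + ‖β p.1‖ₑ := by
            rw [add_comm]; exact enorm_sub_le
          rw [hG, enorm_mul, enorm_mul, enorm_mul, ← add_mul]
          calc _ ≤ (‖β p.2‖ₑ + ‖β p.1‖ₑ) * ‖K p.1 p.2 - k₀‖ₑ * 1 * 1 := by gcongr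
            _ = _ := by simp
      _ = (∫⁻ p, ‖β p.2‖ₑ * ‖K p.1 p.2 - k₀‖ₑ ∂(mv.prod mu)) +
          ∫⁻ p, ‖β p.1‖ₑ * ‖K p.1 p.2 - k₀‖ₑ ∂(mv.prod mu) :=
          lintegral_add_left' (hβ2.enorm.mul hKm.enorm) _
      _ = (∫⁻ y, ‖β y‖ₑ * ∫⁻ x, ‖K x y - k₀‖ₑ ∂mv ∂mu) +
          ∫⁻ x, ‖β x‖ₑ * ∫⁻ y, ‖K x y - k₀‖ₑ ∂mu ∂mv := by
          congr 1
          · refine (lintegral_prod_symm _ (hβ2.enorm.mul hKm.enorm)).trans ?_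
            refine lintegral_congr fun y => ?_
            exact lintegral_const_mul' ‖β y‖ₑ (fun x => ‖K x y - k₀‖ₑ) enorm_ne_top
          · refine (lintegral_prod _ (hβ1.enorm.mul hKm.enorm)).trans ?_
            refine lintegral_congr fun x => ?_
            exact lintegral_const_mul' ‖β x‖ₑ (fun y => ‖K x y - k₀‖ₑ) enorm_ne_top
      _ ≤ (∫⁻ y, ‖β y‖ₑ * c ∂mu) + ∫⁻ x, ‖β x‖ₑ * c ∂mv := by
          gcongr ?_ + ?_
          · refine setLIntegral_mono' (measurableSet_cube u ℓ) fun y hy => ?_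
            gcongr; exact h.left y hy
          · refine setLIntegral_mono' (measurableSet_cube v ℓ) fun x hx => ?_
            gcongr; exact h.right x hx
      _ = _ := by
          have hctop : c ≠ ∞ := by rw [hc]; finiteness
          rw [lintegral_mul_const' _ _ hctop, lintegral_mul_const' _ _ hctop, ← add_mul, mul_comm]
  have hctop : c ≠ ∞ := by rw [hc]; finiteness
  have hGi : Integrable G (mv.prod mu) := ⟨hGm, lt_of_le_of_lt hGle
    (ENNReal.mul_lt_top hctop.lt_top (ENNReal.add_lt_top.2 ⟨hβu.2, hβv.2⟩))⟩
  have hform : commutatorForm K β f g = (∫ p, G p ∂(mv.prod mu)) + ∫ p, H p ∂(mv.prod mu) := by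
    rw [commutatorForm_eq_setIntegral K β hf hg, ← integral_add hGi hHi]
    refine Eq.trans ?_ (integral_prod _ (hGi.add hHi)).symm
    refine integral_congr_ae (Eventually.of_forall fun x => ?_)
    refine integral_congr_ae (Eventually.of_forall fun y => ?_)
    simp only [hG, hH, Pi.add_apply]
    ring
  have hHe : ∫ p, H p ∂(mv.prod mu) = k₀ * ((∫ x in cube v ℓ, β x * g x) * (∫ y in cube u ℓ, f y) -
      (∫ x in cube v ℓ, g x) * (∫ y in cube u ℓ, β y * f y)) := by
    rw [hH, integral_const_mul, integral_sub hH1 hH2,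
      integral_prod_mul (fun x => β x * g x) f, integral_prod_mul g (fun y => β y * f y)]
  rw [hform, hHe, add_sub_cancel_right]
  have hfinal := (enorm_integral_le_lintegral_enorm G).trans hGle
  rw [← ofReal_norm, ← ofReal_integral_norm_eq_lintegral_enorm hβu,
    ← ofReal_integral_norm_eq_lintegral_enorm hβv, ← ENNReal.ofReal_add (by positivity)
    (by positivity), hc, ← ofReal_norm, ← ENNReal.ofReal_pow hℓ.le,
    ← ENNReal.ofReal_mul (norm_nonneg _), ← ENNReal.ofReal_ofNat 6,
    ← ENNReal.ofReal_div_of_pos (by norm_num), ← ENNReal.ofReal_mul (by positivity),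
    ENNReal.ofReal_le_ofReal_iff (by positivity)] at hfinal
  exact hfinal

/-- The conjugate sign of a complex number. -/
noncomputable def conjSign (z : ℂ) : ℂ := (starRingEnd ℂ) z / (‖z‖ : ℂ)

lemma norm_conjSign_le (z : ℂ) : ‖conjSign z‖ ≤ 1 := by
  rw [conjSign, norm_div, RCLike.norm_conj, Complex.norm_real, norm_norm]
  exact div_self_le_one _

lemma mul_conjSign (z : ℂ) : z * conjSign z = (‖z‖ : ℂ) := by
  by_cases hz : z = 0
  · simp [hz]
  · have : (‖z‖ : ℂ) ≠ 0 := by exact_mod_cast norm_ne_zero_iff.2 hz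
    rw [conjSign, ← mul_div_assoc, Complex.mul_conj', pow_two, mul_div_assoc, div_self this, mul_one]

lemma measurable_conjSign : Measurable conjSign := by
  unfold conjSign
  exact (Complex.continuous_conj.measurable).div (Complex.measurable_ofReal.comp measurable_norm)

lemma memLinftyOn_of_norm_le_one {f : EuclideanSpace ℝ (Fin d) → ℂ}
    {Q : Set (EuclideanSpace ℝ (Fin d))} (hQ : MeasurableSet Q)
    (hfm : AEStronglyMeasurable f (volume.restrict Q)) (hf1 : ∀ y, ‖f y‖ ≤ 1)
    (hf : ∀ y, y ∉ Q → f y = 0) : MemLinftyOn f Q ∧ eLpNorm f ∞ volume ≤ 1 := by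
  have hfe : Q.indicator f = f := Set.indicator_eq_self.2 fun y hy => by
    by_contra hyQ
    exact hy (hf y hyQ)
  have hm : AEStronglyMeasurable f volume := by
    rw [← hfe]; exact (aestronglyMeasurable_indicator_iff hQ).2 hfm
  refine ⟨⟨memLp_top_of_bound hm 1 (Eventually.of_forall hf1), Eventually.of_forall hf⟩, ?_⟩
  rw [eLpNorm_exponent_top]
  refine (eLpNormEssSup_le_of_ae_bound (C := 1) (Eventually.of_forall hf1)).trans ?_
  simp

/-- With `β` of mean zero on `Q`, the main terms of the pairs `(1, 1)`, `(sign, 1)`, `(1, sign)`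
control in turn the integral of `β` over the partner, `∫_Q |β|` up to that integral, and `∫ |β|`
over the partner. The third pair serves only to absorb the error. -/
lemma IsAlmostConstantOn.exists_osc_le
    {K : EuclideanSpace ℝ (Fin d) → EuclideanSpace ℝ (Fin d) → ℂ} {k₀ : ℂ}
    {u v : EuclideanSpace ℝ (Fin d)} {ℓ δ : ℝ} (hℓ : 0 < ℓ) (hδ : 0 < δ)
    (hk : δ ≤ ‖k₀‖ * ℓ ^ d) (h : IsAlmostConstantOn K k₀ u v ℓ)
    {b : EuclideanSpace ℝ (Fin d) → ℂ} (hb : LocallyIntegrable b volume) :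
    ∃ f g : Fin 3 → EuclideanSpace ℝ (Fin d) → ℂ,
      (∀ j, MemLinftyOn (f j) (cube u ℓ) ∧ eLpNorm (f j) ∞ volume ≤ 1) ∧
      (∀ j, MemLinftyOn (g j) (cube v ℓ) ∧ eLpNorm (g j) ∞ volume ≤ 1) ∧
      osc b (cube u ℓ) ≤ ENNReal.ofReal (2 / δ) * ∑ j, ‖commutatorForm K b (f j) (g j)‖ₑ := by
  have hbI : ∀ w, IntegrableOn b (cube w ℓ) := fun w =>
    (hb.integrableOn_isCompact (isCompact_closedBall w (√d * ℓ))).mono_set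
      (cube_subset_closedBall w hℓ)
  have hvolr : ∀ w : EuclideanSpace ℝ (Fin d), volume.real (cube w ℓ) = ℓ ^ d := fun w => by
    rw [measureReal_def, volume_cube, ENNReal.toReal_pow, ENNReal.toReal_ofReal hℓ.le]
  set c := ⨍ y in cube u ℓ, b y with hc
  set β : EuclideanSpace ℝ (Fin d) → ℂ := fun x => b x - c with hβ
  have hβI : ∀ w, IntegrableOn β (cube w ℓ) := fun w =>
    (hbI w).sub (integrableOn_const (volume_cube_ne_top _ _))
  have hmean : ∫ y in cube u ℓ, β y = 0 := by
    rw [hβ, integral_sub (hbI u) (integrableOn_const (volume_cube_ne_top _ _)), setIntegral_const,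
      hc, setAverage_eq, smul_smul, hvolr, mul_inv_cancel₀ (by positivity), one_smul, sub_self]
  have hsm : ∀ w, AEStronglyMeasurable (fun x => conjSign (β x)) (volume.restrict (cube w ℓ)) :=
    fun w => (measurable_conjSign.comp_aemeasurable
      (hβI w).aestronglyMeasurable.aemeasurable).aestronglyMeasurable
  -- the two kinds of test functions on a cube
  set o : EuclideanSpace ℝ (Fin d) → EuclideanSpace ℝ (Fin d) → ℂ :=
    fun w => (cube w ℓ).indicator (fun _ => 1) with ho
  set s : EuclideanSpace ℝ (Fin d) → EuclideanSpace ℝ (Fin d) → ℂ :=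
    fun w => (cube w ℓ).indicator (fun x => conjSign (β x)) with hs
  have hom : ∀ w, AEStronglyMeasurable (o w) (volume.restrict (cube w ℓ)) := fun w =>
    (aestronglyMeasurable_const.indicator (measurableSet_cube w ℓ))
  have hsm' : ∀ w, AEStronglyMeasurable (s w) (volume.restrict (cube w ℓ)) := fun w =>
    ((hsm w).indicator (measurableSet_cube w ℓ))
  have ho1 : ∀ w x, ‖o w x‖ ≤ 1 := fun w x => by
    refine (norm_indicator_le_norm_self _ _).trans ?_
    simp
  have hs1 : ∀ w x, ‖s w x‖ ≤ 1 := fun w x =>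
    (norm_indicator_le_norm_self _ _).trans (norm_conjSign_le _)
  have ho0 : ∀ w x, x ∉ cube w ℓ → o w x = 0 := fun w x hx => Set.indicator_of_notMem hx _
  have hs0 : ∀ w x, x ∉ cube w ℓ → s w x = 0 := fun w x hx => Set.indicator_of_notMem hx _
  have hIo : ∀ w, ∫ x in cube w ℓ, o w x = ((ℓ ^ d : ℝ) : ℂ) := fun w => by
    rw [setIntegral_congr_fun (g := fun _ => (1 : ℂ)) (measurableSet_cube w ℓ)
      fun x hx => Set.indicator_of_mem hx _, setIntegral_const, hvolr]
    simp
  have hIβo : ∀ w, ∫ x in cube w ℓ, β x * o w x = ∫ x in cube w ℓ, β x := fun w => by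
    refine setIntegral_congr_fun (measurableSet_cube w ℓ) fun x hx => ?_
    simp [ho, Set.indicator_of_mem hx]
  have hIβs : ∀ w, ∫ x in cube w ℓ, β x * s w x = ((∫ x in cube w ℓ, ‖β x‖ : ℝ) : ℂ) := fun w => by
    rw [← integral_complex_ofReal]
    refine setIntegral_congr_fun (measurableSet_cube w ℓ) fun x hx => ?_
    simp only [hs, Set.indicator_of_mem hx]
    exact mul_conjSign _
  have hIs : ‖∫ x in cube u ℓ, s u x‖ ≤ ℓ ^ d := by
    refine (norm_setIntegral_le_of_norm_le_const (volume_cube_ne_top u ℓ).lt_top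
      fun x _ => hs1 u x).trans ?_
    rw [hvolr, one_mul]
  set Su := ∫ y in cube u ℓ, ‖β y‖ with hSu
  set Sv := ∫ x in cube v ℓ, ‖β x‖ with hSv
  have hSu0 : 0 ≤ Su := integral_nonneg fun _ => norm_nonneg _
  have hSv0 : 0 ≤ Sv := integral_nonneg fun _ => norm_nonneg _
  have e1 := h.norm_commutatorForm_sub_le hℓ (hβI u) (hβI v) (hom u) (hom v) (ho1 u) (ho1 v)
    (ho0 u) (ho0 v)
  have e2 := h.norm_commutatorForm_sub_le hℓ (hβI u) (hβI v) (hsm' u) (hom v) (hs1 u) (ho1 v)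
    (hs0 u) (ho0 v)
  have e3 := h.norm_commutatorForm_sub_le hℓ (hβI u) (hβI v) (hom u) (hsm' v) (ho1 u) (hs1 v)
    (ho0 u) (hs0 v)
  rw [commutatorForm_sub_const] at e1 e2 e3
  rw [hIo, hIo, hIβo, hIβo, hmean, mul_zero, sub_zero] at e1
  rw [hIo, hIβo, hIβs] at e2
  rw [hIo, hIβs, hIβo, hmean, mul_zero, sub_zero] at e3
  set I1 := commutatorForm K b (o u) (o v)
  set I2 := commutatorForm K b (s u) (o v)
  set I3 := commutatorForm K b (o u) (s v)
  set m := ∫ x in cube v ℓ, β x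
  have hV : (0 : ℝ) < ℓ ^ d := by positivity
  have n1 : ‖k₀‖ * (‖m‖ * ℓ ^ d) ≤ ‖I1‖ + ‖k₀‖ * ℓ ^ d / 6 * (Su + Sv) := by
    have := norm_sub_norm_le (k₀ * (m * ((ℓ ^ d : ℝ) : ℂ))) I1
    rw [norm_sub_rev] at this
    rw [norm_mul, norm_mul, Complex.norm_real, Real.norm_of_nonneg hV.le] at this
    linarith
  have n2 : ‖k₀‖ * (ℓ ^ d * Su) ≤
      ‖I2‖ + ‖k₀‖ * ℓ ^ d / 6 * (Su + Sv) + ‖k₀‖ * (‖m‖ * ℓ ^ d) := by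
    set J := ∫ x in cube u ℓ, s u x
    have h1 : k₀ * (((ℓ ^ d : ℝ) : ℂ) * (Su : ℂ)) = (I2 - k₀ * (m * J - ((ℓ ^ d : ℝ) : ℂ) *
      (Su : ℂ))) - I2 + k₀ * (m * J) := by ring
    have h2 : ‖k₀ * (((ℓ ^ d : ℝ) : ℂ) * (Su : ℂ))‖ = ‖k₀‖ * (ℓ ^ d * Su) := by
      rw [norm_mul, norm_mul, Complex.norm_real, Complex.norm_real, Real.norm_of_nonneg hV.le,
        Real.norm_of_nonneg hSu0]
    rw [← h2, h1]
    have h3 : ‖k₀ * (m * J)‖ ≤ ‖k₀‖ * (‖m‖ * ℓ ^ d) := by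
      rw [norm_mul, norm_mul]; gcongr
    refine (norm_add_le _ _).trans (add_le_add ?_ h3)
    refine (norm_sub_le _ _).trans ?_
    linarith
  have n3 : ‖k₀‖ * (Sv * ℓ ^ d) ≤ ‖I3‖ + ‖k₀‖ * ℓ ^ d / 6 * (Su + Sv) := by
    have := norm_sub_norm_le (k₀ * ((Sv : ℂ) * ((ℓ ^ d : ℝ) : ℂ))) I3
    rw [norm_sub_rev] at this
    rw [norm_mul, norm_mul, Complex.norm_real, Complex.norm_real, Real.norm_of_nonneg hV.le,
      Real.norm_of_nonneg hSv0] at this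
    linarith
  -- Adding the three inequalities cancels `‖m‖`, and three errors of one sixth make one half of
  -- `‖k₀‖ * ℓ ^ d * (Su + Sv)`, which is absorbed on the left.
  have n4 : ‖k₀‖ * ℓ ^ d * Su ≤ 2 * (‖I1‖ + ‖I2‖ + ‖I3‖) := by
    have : 0 ≤ ‖k₀‖ * ℓ ^ d * Sv := by positivity
    nlinarith
  have n5 : Su ≤ 2 / δ * (‖I1‖ + ‖I2‖ + ‖I3‖) := by
    rw [div_mul_eq_mul_div, le_div_iff₀ hδ]
    nlinarith
  refine ⟨![o u, s u, o u], ![o v, o v, s v], ?_, ?_, ?_⟩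
  · have h1 := memLinftyOn_of_norm_le_one (measurableSet_cube u ℓ) (hom u) (ho1 u) (ho0 u)
    have h2 := memLinftyOn_of_norm_le_one (measurableSet_cube u ℓ) (hsm' u) (hs1 u) (hs0 u)
    intro j
    fin_cases j
    exacts [h1, h2, h1]
  · have h1 := memLinftyOn_of_norm_le_one (measurableSet_cube v ℓ) (hom v) (ho1 v) (ho0 v)
    have h2 := memLinftyOn_of_norm_le_one (measurableSet_cube v ℓ) (hsm' v) (hs1 v) (hs0 v)
    intro j
    fin_cases j
    exacts [h1, h1, h2]
  · have h1 : osc b (cube u ℓ) = ENNReal.ofReal Su := by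
      rw [hSu, ofReal_integral_norm_eq_lintegral_enorm (hβI u)]
      rfl
    rw [h1]
    refine (ENNReal.ofReal_le_ofReal n5).trans (le_of_eq ?_)
    rw [ENNReal.ofReal_mul (by positivity), ENNReal.ofReal_add (by positivity) (by positivity),
      ENNReal.ofReal_add (by positivity) (by positivity), ofReal_norm, ofReal_norm, ofReal_norm,
      Fin.sum_univ_three]
    rfl

end SingleCube

/-! ### A finite maximal operator, and replacing cubes by translates. -/

section Maximal

variable {d : ℕ} {ι : Type*} [Fintype ι]

/-- The absorption step, used twice: divide by `Y ^ (1 / s')`. It needs `Y` finite, which working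
with finite families secures. -/
lemma rpow_inv_le_of_le_mul_rpow {Y a : ℝ≥0∞} {s s' : ℝ} (hs : 0 < s) (hss : 1 / s + 1 / s' = 1)
    (hY : Y ≠ ∞) (h : Y ≤ a * Y ^ (1 / s')) : Y ^ (1 / s) ≤ a := by
  rcases eq_or_ne Y 0 with rfl | hY0
  · rw [ENNReal.zero_rpow_of_pos (by positivity)]; exact zero_le
  · have h1 : Y = Y ^ (1 / s) * Y ^ (1 / s') := by
      rw [← ENNReal.rpow_add _ _ hY0 hY, hss, ENNReal.rpow_one]
    have h2 : Y ^ (1 / s') ≠ 0 := by simp [ENNReal.rpow_eq_zero_iff, hY0, hY]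
    have h3 : Y ^ (1 / s') ≠ ∞ := by simp [ENNReal.rpow_eq_top_iff, hY0, hY]
    exact (ENNReal.mul_le_mul_iff_left h2 h3).1 (h1.symm.le.trans h)

/-- The maximal function of `φ` over finitely many closed balls. -/
noncomputable def ballMaximal (x : ι → EuclideanSpace ℝ (Fin d)) (R : ι → ℝ)
    (φ : EuclideanSpace ℝ (Fin d) → ℝ≥0∞) (y : EuclideanSpace ℝ (Fin d)) : ℝ≥0∞ :=
  ⨆ i, (Metric.closedBall (x i) (R i)).indicator
    (fun _ => (∫⁻ z in Metric.closedBall (x i) (R i), φ z) /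
      volume (Metric.closedBall (x i) (R i))) y

lemma measurable_ballMaximal (x : ι → EuclideanSpace ℝ (Fin d)) (R : ι → ℝ)
    (φ : EuclideanSpace ℝ (Fin d) → ℝ≥0∞) : Measurable (ballMaximal x R φ) :=
  Measurable.iSup fun _ => measurable_const.indicator measurableSet_closedBall

/-- Vitali covering: a disjoint subfamily whose fourfold enlargements cover everything. Any
enlargement factor above `3` would do. -/
lemma volume_iUnion_closedBall_le (x : ι → EuclideanSpace ℝ (Fin d)) (R : ι → ℝ)
    (hR : ∀ i, 0 < R i) (φ : EuclideanSpace ℝ (Fin d) → ℝ≥0∞) (t : ℝ≥0∞) (I : Set ι)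
    (hI : ∀ i ∈ I, t * volume (Metric.closedBall (x i) (R i)) ≤
      ∫⁻ z in Metric.closedBall (x i) (R i), φ z) :
    t * volume (⋃ i ∈ I, Metric.closedBall (x i) (R i)) ≤ 4 ^ d * ∫⁻ z, φ z := by
  obtain ⟨M, hM⟩ : ∃ M, ∀ i, R i ≤ M := by
    obtain ⟨M, hM⟩ := (Set.finite_range R).bddAbove
    exact ⟨M, fun i => hM ⟨i, rfl⟩⟩
  obtain ⟨J, hJI, hJ, hcov⟩ := Vitali.exists_disjoint_subfamily_covering_enlargement_closedBall
    I x R M (fun i _ => hM i) 4 (by norm_num)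
  have hJc : J.Countable := J.toFinite.countable
  calc t * volume (⋃ i ∈ I, Metric.closedBall (x i) (R i))
      ≤ t * volume (⋃ i ∈ J, Metric.closedBall (x i) (4 * R i)) := by
        refine mul_le_mul_right (measure_mono ?_) _
        refine Set.iUnion₂_subset fun i hi => ?_
        obtain ⟨j, hj, hsub⟩ := hcov i hi
        exact hsub.trans (Set.subset_biUnion_of_mem (u := fun j => Metric.closedBall (x j) (4 * R j)) hj)
    _ ≤ t * ∑' i : J, volume (Metric.closedBall (x i) (4 * R i)) := by
        gcongr; exact measure_biUnion_le _ hJc _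
    _ = ∑' i : J, 4 ^ d * (t * volume (Metric.closedBall (x i) (R i))) := by
        rw [← ENNReal.tsum_mul_left]
        refine tsum_congr fun i => ?_
        rw [Measure.addHaar_closedBall_mul _ _ (by norm_num) (hR i).le, finrank_euclideanSpace_fin,
          ENNReal.ofReal_pow (by norm_num), ENNReal.ofReal_ofNat]
        rw [Measure.addHaar_closedBall_center volume (x i)]
        ring
    _ ≤ ∑' i : J, 4 ^ d * ∫⁻ z in Metric.closedBall (x i) (R i), φ z := by
        gcongr with i; exact hI i (hJI i.2)
    _ = 4 ^ d * ∫⁻ z in ⋃ i ∈ J, Metric.closedBall (x i) (R i), φ z := by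
        rw [ENNReal.tsum_mul_left, lintegral_biUnion hJc (fun _ _ => measurableSet_closedBall) hJ]
    _ ≤ 4 ^ d * ∫⁻ z, φ z := by gcongr; exact Measure.restrict_le_self

/-- Since `φ ≤ φ 1_{φ > t} + t`, a ball with mean above `2 * t` has mean at least `t` for the
truncated function. The restriction of the right-hand integral to `{t < φ}` is what interpolation
requires. -/
lemma volume_lt_ballMaximal_le (x : ι → EuclideanSpace ℝ (Fin d)) (R : ι → ℝ)
    (hR : ∀ i, 0 < R i) {φ : EuclideanSpace ℝ (Fin d) → ℝ≥0∞} (hφ : Measurable φ) {t : ℝ≥0∞}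
    (ht : t ≠ ∞) :
    t * volume {y | 2 * t < ballMaximal x R φ y} ≤ 4 ^ d * ∫⁻ z in {z | t < φ z}, φ z := by
  have hms : MeasurableSet {z | t < φ z} := measurableSet_lt measurable_const hφ
  rw [← lintegral_indicator hms]
  set I : Set ι := {i | 2 * t < (∫⁻ z in Metric.closedBall (x i) (R i), φ z) /
      volume (Metric.closedBall (x i) (R i))} with hI
  refine le_trans ?_ (volume_iUnion_closedBall_le x R hR _ t I ?_)
  · gcongr
    intro y hy
    obtain ⟨i, hi⟩ := lt_iSup_iff.1 (show 2 * t < ⨆ i, _ from hy)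
    by_cases hyi : y ∈ Metric.closedBall (x i) (R i)
    · rw [Set.indicator_of_mem hyi] at hi
      exact Set.mem_biUnion (show i ∈ I from hi) hyi
    · rw [Set.indicator_of_notMem hyi] at hi
      exact absurd hi not_lt_zero
  · intro i hi
    have hi' : 2 * t < (∫⁻ z in Metric.closedBall (x i) (R i), φ z) /
      volume (Metric.closedBall (x i) (R i)) := hi
    set B := Metric.closedBall (x i) (R i)
    have hB : volume B ≠ ∞ := measure_closedBall_lt_top.ne
    have h1 : 2 * t * volume B ≤ ∫⁻ z in B, φ z := ENNReal.mul_le_of_le_div hi'.le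
    have h2 : ∫⁻ z in B, φ z ≤ ∫⁻ z in B, ({z | t < φ z}.indicator φ z + t) := by
      refine lintegral_mono fun z => ?_
      by_cases hz : t < φ z
      · rw [Set.indicator_of_mem (show z ∈ {z | t < φ z} from hz)]; exact le_self_add
      · exact (not_lt.1 hz).trans le_add_self
    rw [lintegral_add_right _ measurable_const, setLIntegral_const] at h2
    have h3 : t * volume B + t * volume B ≤
        (∫⁻ z in B, {z | t < φ z}.indicator φ z) + t * volume B := by
      refine le_trans (le_of_eq ?_) (h1.trans h2)
      ring
    exact (ENNReal.add_le_add_iff_right (ENNReal.mul_ne_top ht hB)).1 h3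

/-- Marcinkiewicz interpolation: the layer-cake formula for `M` under Lebesgue measure with exponent
`s`, compared by the weak bound with the layer-cake formula for `2 * φ` under `φ dx` with exponent
`s - 1`. -/
lemma lintegral_ballMaximal_rpow_le {s : ℝ} (hs : 1 < s) (x : ι → EuclideanSpace ℝ (Fin d))
    (R : ι → ℝ) (hR : ∀ i, 0 < R i) {φ : EuclideanSpace ℝ (Fin d) → ℝ≥0} (hφ : Measurable φ)
    (hfin : ∀ i, ∫⁻ z in Metric.closedBall (x i) (R i), φ z ≠ ∞) :
    ∫⁻ y, ballMaximal x R (fun z => φ z) y ^ s ≤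
      (ENNReal.ofReal s * (2 * 4 ^ d) / ENNReal.ofReal (s - 1) * ENNReal.ofReal (2 ^ (s - 1))) *
        ∫⁻ y, (φ y : ℝ≥0∞) ^ s := by
  set M := ballMaximal x R (fun z => (φ z : ℝ≥0∞)) with hM
  have hMm : Measurable M := measurable_ballMaximal _ _ _
  have hs0 : 0 < s := by linarith
  have hMtop : ∀ y, M y ≠ ∞ := by
    intro y
    rw [hM, ballMaximal, ← Finset.sup_univ_eq_iSup]
    refine ((Finset.sup_lt_iff (by simp)).2 fun i _ => ?_).ne
    refine lt_of_le_of_lt (Set.indicator_le_self _ _ _) ?_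
    exact ENNReal.div_lt_top (hfin i) (Metric.measure_closedBall_pos _ _ (hR i)).ne'
  have hφE : Measurable (fun z => (φ z : ℝ≥0∞)) := hφ.coe_nnreal_ennreal
  set m' := (volume : Measure (EuclideanSpace ℝ (Fin d))).withDensity (fun z => (φ z : ℝ≥0∞))
    with hm'
  have h1 : ∫⁻ y, M y ^ s = ∫⁻ y, ENNReal.ofReal ((M y).toReal ^ s) := by
    refine lintegral_congr fun y => ?_
    rw [← ENNReal.ofReal_rpow_of_nonneg ENNReal.toReal_nonneg hs0.le,
      ENNReal.ofReal_toReal (hMtop y)]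
  have h2 := lintegral_rpow_eq_lintegral_meas_lt_mul volume (f := fun y => (M y).toReal)
    (Eventually.of_forall fun _ => ENNReal.toReal_nonneg) hMm.ennreal_toReal.aemeasurable hs0
  have h3 := lintegral_rpow_eq_lintegral_meas_lt_mul m' (f := fun y => 2 * (φ y : ℝ))
    (Eventually.of_forall fun _ => by positivity)
    ((measurable_const.mul hφ.coe_nnreal_real).aemeasurable) (p := s - 1) (by linarith)
  -- The weak bound is used at height `t / 2`; the factor it needs comes from `t ^ (s - 1) = 2 * (t
  -- / 2) * t ^ (s - 2)`.
  have h4 : ∀ t ∈ Set.Ioi (0 : ℝ), volume {y | t < (M y).toReal} * ENNReal.ofReal (t ^ (s - 1)) ≤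
      (2 * 4 ^ d) * (m' {y | t < 2 * (φ y : ℝ)} * ENNReal.ofReal (t ^ (s - 1 - 1))) := by
    intro t ht
    have ht0 : (0 : ℝ) < t := ht
    have hE : ENNReal.ofReal (t / 2) ≠ ∞ := ENNReal.ofReal_ne_top
    have ha := volume_lt_ballMaximal_le x R hR hφE hE
    have e1 : {y | t < (M y).toReal} = {y | 2 * ENNReal.ofReal (t / 2) < M y} := by
      ext y
      change t < (M y).toReal ↔ 2 * ENNReal.ofReal (t / 2) < M y
      rw [← ENNReal.ofReal_ofNat 2, ← ENNReal.ofReal_mul (by norm_num), mul_div_cancel₀ _ two_ne_zero,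
        ENNReal.ofReal_lt_iff_lt_toReal ht0.le (hMtop y)]
    have e2 : {y | t < 2 * (φ y : ℝ)} = {z | ENNReal.ofReal (t / 2) < (φ z : ℝ≥0∞)} := by
      ext y
      change t < 2 * (φ y : ℝ) ↔ ENNReal.ofReal (t / 2) < (φ y : ℝ≥0∞)
      rw [ENNReal.ofReal_lt_iff_lt_toReal (by positivity) ENNReal.coe_ne_top, ENNReal.coe_toReal,
        div_lt_iff₀' two_pos]
    have e3 : m' {y | t < 2 * (φ y : ℝ)} = ∫⁻ z in {z | ENNReal.ofReal (t / 2) < (φ z : ℝ≥0∞)}, φ z := by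
      rw [e2, hm', withDensity_apply _ (measurableSet_lt measurable_const hφE)]
    rw [e3, e1]
    have e4 : ENNReal.ofReal (t ^ (s - 1)) =
        2 * ENNReal.ofReal (t / 2) * ENNReal.ofReal (t ^ (s - 1 - 1)) := by
      rw [← ENNReal.ofReal_ofNat 2, ← ENNReal.ofReal_mul (by norm_num),
        mul_div_cancel₀ _ two_ne_zero, ← ENNReal.ofReal_mul ht0.le, Real.rpow_sub_one ht0.ne' (s - 1)]
      congr 1
      field_simp
    rw [e4]
    calc _ = 2 * (ENNReal.ofReal (t / 2) * volume {y | 2 * ENNReal.ofReal (t / 2) < M y}) *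
          ENNReal.ofReal (t ^ (s - 1 - 1)) := by ring
      _ ≤ 2 * (4 ^ d * ∫⁻ z in {z | ENNReal.ofReal (t / 2) < (φ z : ℝ≥0∞)}, φ z) *
          ENNReal.ofReal (t ^ (s - 1 - 1)) := by gcongr
      _ = _ := by ring
  have h5 : ∫⁻ y, ENNReal.ofReal ((2 * (φ y : ℝ)) ^ (s - 1)) ∂m' =
      ENNReal.ofReal (2 ^ (s - 1)) * ∫⁻ y, (φ y : ℝ≥0∞) ^ s := by
    rw [hm', lintegral_withDensity_eq_lintegral_mul _ hφE (by fun_prop),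
      ← lintegral_const_mul _ (hφE.pow_const s)]
    refine lintegral_congr fun y => ?_
    rw [Pi.mul_apply, Real.mul_rpow (by norm_num) (by positivity), ENNReal.ofReal_mul (by positivity),
      ← ENNReal.ofReal_rpow_of_nonneg (p := s - 1) (NNReal.coe_nonneg (φ y)) (by linarith),
      ENNReal.ofReal_coe_nnreal,
      mul_left_comm]
    congr 1
    nth_rewrite 1 [← ENNReal.rpow_one (φ y : ℝ≥0∞)]
    rw [← ENNReal.rpow_add_of_nonneg _ _ zero_le_one (by linarith)]
    congr 1; ring
  have hs1 : ENNReal.ofReal (s - 1) ≠ 0 := by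
    rw [Ne, ENNReal.ofReal_eq_zero]; linarith
  set T := ∫⁻ t in Set.Ioi (0 : ℝ), m' {y | t < 2 * (φ y : ℝ)} * ENNReal.ofReal (t ^ (s - 1 - 1))
    with hT
  have h6 : T = (ENNReal.ofReal (s - 1))⁻¹ *
      (ENNReal.ofReal (2 ^ (s - 1)) * ∫⁻ y, (φ y : ℝ≥0∞) ^ s) := by
    rw [← h5, h3, ← mul_assoc, ENNReal.inv_mul_cancel hs1 ENNReal.ofReal_ne_top, one_mul]
  calc ∫⁻ y, M y ^ s = ENNReal.ofReal s * ∫⁻ t in Set.Ioi (0 : ℝ),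
        volume {y | t < (M y).toReal} * ENNReal.ofReal (t ^ (s - 1)) := by rw [h1, h2]
    _ ≤ ENNReal.ofReal s * ((2 * 4 ^ d) * T) := by
        gcongr
        rw [hT, ← lintegral_const_mul' _ _ (by finiteness)]
        exact setLIntegral_mono' measurableSet_Ioi h4
    _ = _ := by rw [h6, div_eq_mul_inv]; ring

/-- Replacing cubes by translates at a comparable distance does not increase the `L^s` norm of a
nonnegative combination of their indicators by more than a constant factor. -/
theorem exists_lintegral_translates_le (d : ℕ) {s : ℝ} (hs : 1 < s) {R : ℝ} (hR : 0 ≤ R) :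
    ∃ C : ℝ≥0, ∀ (ι : Type) [Fintype ι] (u v : ι → EuclideanSpace ℝ (Fin d)) (ℓ : ι → ℝ)
      (ν : ι → ℝ≥0), (∀ i, 0 < ℓ i) → (∀ i, dist (u i) (v i) ≤ R * ℓ i) →
      (∫⁻ x, (∑ i, (cube (v i) (ℓ i)).indicator (fun _ => (ν i : ℝ≥0∞)) x) ^ s) ^ (1 / s) ≤
        C * (∫⁻ x, (∑ i, (cube (u i) (ℓ i)).indicator (fun _ => (ν i : ℝ≥0∞)) x) ^ s) ^ (1 / s) := by
  -- The ball of radius `R' * ℓ i` about `u i` contains both the cube and its translate; the `1`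
  -- keeps the radius positive in every dimension.
  set R' : ℝ := R + √d + 1 with hR'
  have hd0 := Real.sqrt_nonneg (d : ℝ)
  have hR'0 : 0 < R' := by positivity
  set s' : ℝ := s / (s - 1) with hs'
  have hs0 : 0 < s := by linarith
  have hs10 : 0 < s - 1 := by linarith
  have hconj : s.HolderConjugate s' := Real.HolderConjugate.conjExponent hs
  set A : ℝ≥0∞ := ENNReal.ofReal R' ^ d *
    volume (Metric.closedBall (0 : EuclideanSpace ℝ (Fin d)) 1) with hA
  set B : ℝ≥0∞ := ENNReal.ofReal s' * (2 * 4 ^ d) / ENNReal.ofReal (s' - 1) *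
    ENNReal.ofReal (2 ^ (s' - 1)) with hB
  have hAtop : A ≠ ∞ := ENNReal.mul_ne_top (by finiteness) measure_closedBall_lt_top.ne
  have hs'1 : 1 < s' := hconj.symm.lt
  have hs'0 : 0 < s' := by linarith
  have hBtop : B ≠ ∞ := by
    refine ENNReal.mul_ne_top (ENNReal.div_ne_top (by finiteness) ?_) ENNReal.ofReal_ne_top
    rw [Ne, ENNReal.ofReal_eq_zero]; linarith
  refine ⟨(A * B ^ (1 / s')).toNNReal, fun ι _ u v ℓ ν hℓ huv => ?_⟩
  rw [ENNReal.coe_toNNReal (ENNReal.mul_ne_top hAtop (ENNReal.rpow_ne_top_of_nonneg (by positivity)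
    hBtop))]
  set g : EuclideanSpace ℝ (Fin d) → ℝ≥0∞ := fun x =>
    ∑ i, (cube (u i) (ℓ i)).indicator (fun _ => (ν i : ℝ≥0∞)) x with hg
  set h : EuclideanSpace ℝ (Fin d) → ℝ≥0 := fun x =>
    ∑ i, (cube (v i) (ℓ i)).indicator (fun _ => ν i) x with hh
  have hhE : ∀ x, ∑ i, (cube (v i) (ℓ i)).indicator (fun _ => (ν i : ℝ≥0∞)) x = (h x : ℝ≥0∞) := by
    intro x
    rw [hh, ENNReal.ofNNReal_finsetSum]
    refine Finset.sum_congr rfl fun i _ => ?_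
    by_cases hx : x ∈ cube (v i) (ℓ i) <;> simp [hx]
  have hhm : Measurable h := Finset.measurable_fun_sum _ fun i _ =>
    measurable_const.indicator (measurableSet_cube _ _)
  have hgm : Measurable g := Finset.measurable_fun_sum _ fun i _ =>
    measurable_const.indicator (measurableSet_cube _ _)
  -- The extremal dual function: `h ^ s = h * φ` and `φ ^ s' = h ^ s`. Each integral of `φ` over a
  -- translate is moved to the original cube at the price of the maximal function, then Hölder and
  -- the `L^{s'}` bound give `Y ≲ ‖g‖_s * Y ^ (1 / s')`.
  set φ : EuclideanSpace ℝ (Fin d) → ℝ≥0 := fun x => h x ^ (s - 1) with hφ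
  have hφm : Measurable φ := hhm.pow_const _
  have hhle : ∀ x, h x ≤ ∑ i, ν i := fun x =>
    Finset.sum_le_sum fun i _ => Set.indicator_le_self _ _ _
  have hφle : ∀ x, (φ x : ℝ≥0∞) ≤ (((∑ i, ν i) ^ (s - 1) : ℝ≥0) : ℝ≥0∞) := fun x => by
    rw [ENNReal.coe_le_coe]
    exact NNReal.rpow_le_rpow (hhle x) hs10.le
  have hφint : ∀ Q : Set (EuclideanSpace ℝ (Fin d)), volume Q ≠ ∞ →
      ∫⁻ z in Q, (φ z : ℝ≥0∞) ≠ ∞ := fun Q hQ => by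
    refine ne_top_of_le_ne_top ?_ (lintegral_mono fun z => hφle z)
    rw [lintegral_const, Measure.restrict_apply_univ]
    exact ENNReal.mul_ne_top ENNReal.coe_ne_top hQ
  set Y := ∫⁻ x, (h x : ℝ≥0∞) ^ s with hY
  have hsplit : ∀ x, (h x : ℝ≥0∞) ^ s =
      ∑ i, (cube (v i) (ℓ i)).indicator (fun x => (ν i : ℝ≥0∞) * φ x) x := by
    intro x
    have e1 : (h x : ℝ≥0∞) ^ s = h x * φ x := by
      rw [hφ, ENNReal.coe_rpow_of_nonneg _ hs10.le]
      nth_rewrite 2 [← ENNReal.rpow_one (h x : ℝ≥0∞)]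
      rw [← ENNReal.rpow_add_of_nonneg _ _ zero_le_one hs10.le]
      congr 1; ring
    rw [e1, ← hhE, Finset.sum_mul]
    refine Finset.sum_congr rfl fun i _ => ?_
    by_cases hx : x ∈ cube (v i) (ℓ i) <;> simp [hx]
  have hYsum : Y = ∑ i, (ν i : ℝ≥0∞) * ∫⁻ x in cube (v i) (ℓ i), φ x := by
    rw [hY, lintegral_congr hsplit, lintegral_finsetSum]
    · refine Finset.sum_congr rfl fun i _ => ?_
      rw [lintegral_indicator (measurableSet_cube _ _),
        lintegral_const_mul' _ _ ENNReal.coe_ne_top]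
    · exact fun i _ => (measurable_const.mul hφm.coe_nnreal_ennreal).indicator
        (measurableSet_cube _ _)
  have hYtop : Y ≠ ∞ := by
    rw [hYsum, ENNReal.sum_ne_top]
    exact fun i _ => ENNReal.mul_ne_top ENNReal.coe_ne_top (hφint _ (volume_cube_ne_top _ _))
  have hrad : ∀ i, 0 < R' * ℓ i := fun i => mul_pos hR'0 (hℓ i)
  set M := ballMaximal u (fun i => R' * ℓ i) (fun z => (φ z : ℝ≥0∞)) with hM
  have hMs : ∫⁻ y, M y ^ s' ≤ B * ∫⁻ y, (φ y : ℝ≥0∞) ^ s' :=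
    lintegral_ballMaximal_rpow_le hs'1 u _ hrad hφm fun i =>
      hφint _ measure_closedBall_lt_top.ne
  have hφs : ∫⁻ y, (φ y : ℝ≥0∞) ^ s' = Y := by
    refine lintegral_congr fun y => ?_
    rw [hφ, ENNReal.coe_rpow_of_nonneg _ hs10.le, ← ENNReal.rpow_mul, hs',
      mul_div_cancel₀ _ hs10.ne']
  have hone : ∀ i, ∫⁻ x in cube (v i) (ℓ i), (φ x : ℝ≥0∞) ≤
      A * ∫⁻ x in cube (u i) (ℓ i), M x := by
    intro i
    set D := Metric.closedBall (u i) (R' * ℓ i) with hD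
    have hv : cube (v i) (ℓ i) ⊆ D := by
      refine (cube_subset_closedBall (v i) (hℓ i)).trans (Metric.closedBall_subset_closedBall' ?_)
      rw [dist_comm]
      have := huv i
      have := hℓ i
      rw [hR']; linarith
    have hu : cube (u i) (ℓ i) ⊆ D := by
      refine (cube_subset_closedBall (u i) (hℓ i)).trans (Metric.closedBall_subset_closedBall ?_)
      have := hℓ i
      rw [hR']
      have := mul_nonneg hR this.le
      linarith
    have hDvol : volume D = A * volume (cube (u i) (ℓ i)) := by
      rw [hD, Measure.addHaar_closedBall' _ _ (hrad i).le, finrank_euclideanSpace_fin, volume_cube,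
        hA, ENNReal.ofReal_pow (hrad i).le, ENNReal.ofReal_mul hR'0.le, mul_pow]
      ring
    have hD0 : volume D ≠ 0 := (Metric.measure_closedBall_pos _ _ (hrad i)).ne'
    have hDtop : volume D ≠ ∞ := measure_closedBall_lt_top.ne
    calc ∫⁻ x in cube (v i) (ℓ i), (φ x : ℝ≥0∞) ≤ ∫⁻ x in D, (φ x : ℝ≥0∞) :=
          lintegral_mono_set hv
      _ = A * ((∫⁻ x in D, (φ x : ℝ≥0∞)) / volume D * volume (cube (u i) (ℓ i))) := by
          rw [mul_left_comm, ← hDvol, ENNReal.div_mul_cancel hD0 hDtop]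
      _ = A * ∫⁻ x in cube (u i) (ℓ i), (∫⁻ x in D, (φ x : ℝ≥0∞)) / volume D := by
          rw [setLIntegral_const]
      _ ≤ A * ∫⁻ x in cube (u i) (ℓ i), M x := by
          gcongr A * ?_
          refine setLIntegral_mono' (measurableSet_cube _ _) fun x hx => ?_
          rw [hM, ballMaximal]
          refine le_iSup_of_le i ?_
          rw [Set.indicator_of_mem (hu hx)]
  have hMm : Measurable M := measurable_ballMaximal _ _ _
  have hYle : Y ≤ A * B ^ (1 / s') * (∫⁻ x, g x ^ s) ^ (1 / s) * Y ^ (1 / s') := by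
    calc Y ≤ ∑ i, (ν i : ℝ≥0∞) * (A * ∫⁻ x in cube (u i) (ℓ i), M x) := by
          rw [hYsum]; gcongr with i; exact hone i
      _ = A * ∑ i, ∫⁻ x, (cube (u i) (ℓ i)).indicator (fun x => (ν i : ℝ≥0∞) * M x) x := by
          rw [Finset.mul_sum]
          refine Finset.sum_congr rfl fun i _ => ?_
          rw [lintegral_indicator (measurableSet_cube _ _), lintegral_const_mul _ hMm]
          ring
      _ = A * ∫⁻ x, (g * M) x := by
          rw [← lintegral_finsetSum]
          · congr 2
            ext x
            rw [Pi.mul_apply, hg, Finset.sum_mul]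
            refine Finset.sum_congr rfl fun i _ => ?_
            by_cases hx : x ∈ cube (u i) (ℓ i) <;> simp [hx]
          · exact fun i _ => (measurable_const.mul hMm).indicator (measurableSet_cube _ _)
      _ ≤ A * ((∫⁻ x, g x ^ s) ^ (1 / s) * (∫⁻ x, M x ^ s') ^ (1 / s')) := by
          gcongr
          exact ENNReal.lintegral_mul_le_Lp_mul_Lq volume hconj hgm.aemeasurable hMm.aemeasurable
      _ ≤ A * ((∫⁻ x, g x ^ s) ^ (1 / s) * (B * Y) ^ (1 / s')) := by
          gcongr
          rw [← hφs]; exact hMs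
      _ = _ := by
          rw [ENNReal.mul_rpow_of_nonneg _ _ (by positivity)]
          ring
  have hfin := rpow_inv_le_of_le_mul_rpow hs0 (s' := s') (by
    have := hconj.inv_add_inv_eq_one
    rwa [one_div, one_div]) hYtop hYle
  rw [lintegral_congr fun x => by rw [hhE x]]
  exact hfin

end Maximal

/-! ### From the testing condition to weighted sums of oscillations. -/

section Testing

variable {d : ℕ}

lemma commutatorForm_smul (K : EuclideanSpace ℝ (Fin d) → EuclideanSpace ℝ (Fin d) → ℂ)
    (b f g : EuclideanSpace ℝ (Fin d) → ℂ) (α β : ℂ) :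
    commutatorForm K b (fun y => α * f y) (fun x => β * g x) = α * β * commutatorForm K b f g := by
  rw [commutatorForm, commutatorForm, ← integral_const_mul]
  congr 1
  ext x
  rw [← integral_const_mul]
  congr 1
  ext y
  ring

lemma MemLinftyOn.const_mul {f : EuclideanSpace ℝ (Fin d) → ℂ} {Q : Set (EuclideanSpace ℝ (Fin d))}
    (hf : MemLinftyOn f Q) (α : ℂ) : MemLinftyOn (fun y => α * f y) Q :=
  ⟨hf.1.const_mul α, by filter_upwards [hf.2] with x hx hxQ; rw [hx hxQ, mul_zero]⟩

lemma eLpNorm_sum_indicator_le {N : ℕ} (Q : Fin N → Set (EuclideanSpace ℝ (Fin d)))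
    (a : Fin N → ℝ≥0∞) (c : Fin N → ℝ≥0) (hac : ∀ i, a i ≤ c i) {p : ℝ} (hp : 0 < p) :
    eLpNorm (fun x => ∑ i, (Q i).indicator (fun _ => a i) x) (ENNReal.ofReal p) volume ≤
      (∫⁻ x, (∑ i, (Q i).indicator (fun _ => (c i : ℝ≥0∞)) x) ^ p) ^ (1 / p) := by
  rw [eLpNorm_eq_lintegral_rpow_enorm_toReal (by simpa using hp) ENNReal.ofReal_ne_top,
    ENNReal.toReal_ofReal hp.le]
  gcongr with x i
  simp only [enorm_eq_self]
  gcongr with i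
  exact hac i

/-- The testing condition controls weighted sums of mean oscillations. -/
theorem HasPartnerCubes.exists_sum_osc_le
    {K : EuclideanSpace ℝ (Fin d) → EuclideanSpace ℝ (Fin d) → ℂ} (hK : HasPartnerCubes K)
    {p q κ : ℝ} (hq : 1 < q) (hp : 0 < p) (hκ : 0 < κ) :
    ∃ C : ℝ≥0, ∀ (b : EuclideanSpace ℝ (Fin d) → ℂ) (Θ : ℝ≥0), LocallyIntegrable b volume →
      WeakCommutatorBound K b p q κ Θ → ∀ (ι : Type) [Fintype ι]
      (u : ι → EuclideanSpace ℝ (Fin d)) (ℓ : ι → ℝ) (μ ν : ι → ℝ≥0), (∀ i, 0 < ℓ i) →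
      ∑ i, (μ i : ℝ≥0∞) * ν i * osc b (cube (u i) (ℓ i)) ≤ C * Θ *
        (∫⁻ x, (∑ i, (cube (u i) (ℓ i)).indicator (fun _ => (μ i : ℝ≥0∞)) x) ^ p) ^ (1 / p) *
        (∫⁻ x, (∑ i, (cube (u i) (ℓ i)).indicator (fun _ => (ν i : ℝ≥0∞)) x) ^ (q / (q - 1))) ^
          (1 / (q / (q - 1))) := by
  have hconj : q.HolderConjugate (q / (q - 1)) := Real.HolderConjugate.conjExponent hq
  -- Separation is measured by side length for partner cubes and by diameter in the hypothesis; the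
  -- diameter is at most `√d * ℓ`.
  obtain ⟨δ, R, hδ, hR, hpart⟩ := hK (κ * √d)
  obtain ⟨C₁, hC₁⟩ := exists_lintegral_translates_le d hconj.symm.lt hR
  refine ⟨Real.toNNReal (2 / δ) * 3 * C₁, fun b Θ hb hW => ?_⟩
  have main : ∀ (N : ℕ) (u : Fin N → EuclideanSpace ℝ (Fin d)) (ℓ : Fin N → ℝ)
      (μ ν : Fin N → ℝ≥0), (∀ i, 0 < ℓ i) →
      ∑ i, (μ i : ℝ≥0∞) * ν i * osc b (cube (u i) (ℓ i)) ≤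
        ((Real.toNNReal (2 / δ) * 3 * C₁ : ℝ≥0) : ℝ≥0∞) * Θ *
        (∫⁻ x, (∑ i, (cube (u i) (ℓ i)).indicator (fun _ => (μ i : ℝ≥0∞)) x) ^ p) ^ (1 / p) *
        (∫⁻ x, (∑ i, (cube (u i) (ℓ i)).indicator (fun _ => (ν i : ℝ≥0∞)) x) ^ (q / (q - 1))) ^
          (1 / (q / (q - 1))) := by
    intro N u ℓ μ ν hℓ
    choose v k₀ hsep hdist hk hAC using fun i => hpart (u i) (ℓ i) (hℓ i)
    choose f g hf hg hosc using fun i => (hAC i).exists_osc_le (hℓ i) hδ (hk i) hb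
    set P := (∫⁻ x, (∑ i, (cube (u i) (ℓ i)).indicator (fun _ => (μ i : ℝ≥0∞)) x) ^ p) ^ (1 / p)
    set P' := (∫⁻ x, (∑ i, (cube (u i) (ℓ i)).indicator (fun _ => (ν i : ℝ≥0∞)) x) ^
      (q / (q - 1))) ^ (1 / (q / (q - 1)))
    -- One application of the hypothesis for each of the three test pairs. The functions `f` live on
    -- the original cubes, so only the `q'`-norm has to be transported back from the partners.
    have hj : ∀ j, ∑ i, (μ i : ℝ≥0∞) * ν i * ‖commutatorForm K b (f i j) (g i j)‖ₑ ≤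
        Θ * P * (C₁ * P') := by
      intro j
      have h1 := hW N u v ℓ (fun i y => ((μ i : ℝ) : ℂ) * f i j y)
        (fun i x => ((ν i : ℝ) : ℂ) * g i j x) hℓ
        (fun i x hx y hy => by
          refine le_trans ?_ (hsep i x hx y hy)
          rw [mul_assoc]
          gcongr
          exact diam_cube_le _ (hℓ i).le)
        (fun i => (hf i j).1.const_mul _) (fun i => (hg i j).1.const_mul _)
      have hn : ∀ a : ℝ≥0, ‖((a : ℝ) : ℂ)‖ₑ = a := fun a => by
        rw [← ofReal_norm, Complex.norm_real, Real.norm_of_nonneg a.coe_nonneg, ENNReal.ofReal_coe_nnreal]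
      have hnorm : ∀ (a : ℝ≥0) (F : EuclideanSpace ℝ (Fin d) → ℂ), eLpNorm F ∞ volume ≤ 1 →
          eLpNorm (fun y => ((a : ℝ) : ℂ) * F y) ∞ volume ≤ a := by
        intro a F hF
        have := eLpNorm_const_smul ((a : ℝ) : ℂ) F ∞ (volume : Measure (EuclideanSpace ℝ (Fin d)))
        change eLpNorm (((a : ℝ) : ℂ) • F) ∞ volume ≤ a
        rw [this, hn]
        exact mul_le_of_le_one_right' hF
      refine le_trans (le_of_eq ?_) (h1.trans ?_)
      · refine Finset.sum_congr rfl fun i _ => ?_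
        rw [commutatorForm_smul, enorm_mul, enorm_mul, hn, hn]
      · refine mul_le_mul' (mul_le_mul' le_rfl ?_) ?_
        · exact eLpNorm_sum_indicator_le _ _ _ (fun i => hnorm _ _ (hf i j).2) hp
        · exact (eLpNorm_sum_indicator_le _ _ _ (fun i => hnorm _ _ (hg i j).2) hconj.symm.pos).trans
            (hC₁ _ u v ℓ ν hℓ hdist)
    calc ∑ i, (μ i : ℝ≥0∞) * ν i * osc b (cube (u i) (ℓ i))
        ≤ ∑ i, (μ i : ℝ≥0∞) * ν i * (ENNReal.ofReal (2 / δ) *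
            ∑ j, ‖commutatorForm K b (f i j) (g i j)‖ₑ) := by gcongr with i; exact hosc i
      _ = ENNReal.ofReal (2 / δ) * ∑ j, ∑ i, (μ i : ℝ≥0∞) * ν i *
            ‖commutatorForm K b (f i j) (g i j)‖ₑ := by
          rw [Finset.sum_comm, Finset.mul_sum]
          refine Finset.sum_congr rfl fun i _ => ?_
          rw [← Finset.mul_sum]; ring
      _ ≤ ENNReal.ofReal (2 / δ) * ∑ _j : Fin 3, Θ * P * (C₁ * P') := by gcongr with j; exact hj j
      _ = _ := by
          rw [Finset.sum_const, Finset.card_univ, Fintype.card_fin, nsmul_eq_mul, ENNReal.coe_mul,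
            ENNReal.coe_mul, ENNReal.ofReal]
          push_cast
          ring
  intro ι _ u ℓ μ ν hℓ
  have e := (Fintype.equivFin ι).symm
  have := main _ (u ∘ e) (ℓ ∘ e) (μ ∘ e) (ν ∘ e) fun i => hℓ _
  simp only [Function.comp] at this
  rw [Equiv.sum_comp e (fun i => (μ i : ℝ≥0∞) * ν i * osc b (cube (u i) (ℓ i)))] at this
  simp_rw [fun x => Equiv.sum_comp e
    (fun i => (cube (u i) (ℓ i)).indicator (fun _ => (μ i : ℝ≥0∞)) x),
    fun x => Equiv.sum_comp e
    (fun i => (cube (u i) (ℓ i)).indicator (fun _ => (ν i : ℝ≥0∞)) x)] at this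
  exact this

end Testing

/-! ### Stopping sets and the maximal function of a finite laminar family. -/

section Laminar

variable {X : Type} [MeasureSpace X]

/-- A finite laminar family of sets with a largest element `Q₀`, in which every other set has a
strictly larger member of comparable measure. -/
structure IsLaminarFamily (𝒟 : Finset (Set X)) (Q₀ : Set X) (M : ℝ≥0) : Prop where
  root_mem : Q₀ ∈ 𝒟
  subset_root : ∀ Q ∈ 𝒟, Q ⊆ Q₀
  measurableSet : ∀ Q ∈ 𝒟, MeasurableSet Q
  volume_ne_zero : ∀ Q ∈ 𝒟, volume Q ≠ 0
  volume_ne_top : ∀ Q ∈ 𝒟, volume Q ≠ ∞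
  laminar : ∀ Q ∈ 𝒟, ∀ P ∈ 𝒟, Disjoint Q P ∨ Q ⊆ P ∨ P ⊆ Q
  parent : ∀ Q ∈ 𝒟, Q ≠ Q₀ → ∃ P ∈ 𝒟, Q ⊂ P ∧ volume P ≤ M * volume Q

/-- The mean value of `‖f‖` over `Q`. -/
noncomputable def meanNorm (f : X → ℂ) (Q : Set X) : ℝ≥0∞ := (∫⁻ x in Q, ‖f x‖ₑ) / volume Q

/-- The maximal function of `f` over the members of `𝒟`. -/
noncomputable def familyMaximal (𝒟 : Finset (Set X)) (f : X → ℂ) (x : X) : ℝ≥0∞ :=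
  𝒟.sup fun Q => Q.indicator (fun _ => meanNorm f Q) x

open Classical in
/-- The maximal members of `𝒟` on which the mean of `‖f‖` is at least `t`. -/
noncomputable def stoppingSets (𝒟 : Finset (Set X)) (f : X → ℂ) (t : ℝ≥0∞) : Finset (Set X) :=
  𝒟.filter fun Q => t ≤ meanNorm f Q ∧ ∀ P ∈ 𝒟, Q ⊂ P → meanNorm f P < t

lemma mem_stoppingSets {𝒟 : Finset (Set X)} {f : X → ℂ} {t : ℝ≥0∞} {Q : Set X} :
    Q ∈ stoppingSets 𝒟 f t ↔
      Q ∈ 𝒟 ∧ t ≤ meanNorm f Q ∧ ∀ P ∈ 𝒟, Q ⊂ P → meanNorm f P < t := by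
  classical
  simp [stoppingSets]

variable {𝒟 : Finset (Set X)} {Q₀ : Set X} {M : ℝ≥0} {f : X → ℂ}

lemma IsLaminarFamily.pairwiseDisjoint_stoppingSets (h : IsLaminarFamily 𝒟 Q₀ M) (t : ℝ≥0∞) :
    (stoppingSets 𝒟 f t : Set (Set X)).PairwiseDisjoint id := by
  intro Q hQ P hP hne
  rw [Finset.mem_coe, mem_stoppingSets] at hQ hP
  rcases h.laminar Q hQ.1 P hP.1 with h1 | h1 | h1
  · exact h1
  · exact absurd (hQ.2.2 P hP.1 (h1.ssubset_of_ne hne)) (not_lt.2 hP.2.1)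
  · exact absurd (hP.2.2 Q hQ.1 (h1.ssubset_of_ne hne.symm)) (not_lt.2 hQ.2.1)

lemma exists_mem_stoppingSets {t : ℝ≥0∞} {Q : Set X} (hQ : Q ∈ 𝒟) (ht : t ≤ meanNorm f Q) :
    ∃ P ∈ stoppingSets 𝒟 f t, Q ⊆ P := by
  classical
  obtain ⟨P, hQP, hP⟩ := (𝒟.filter fun Q => t ≤ meanNorm f Q).exists_le_maximal
    (Finset.mem_filter.2 ⟨hQ, ht⟩)
  have hP1 := Finset.mem_filter.1 hP.1
  refine ⟨P, mem_stoppingSets.2 ⟨hP1.1, hP1.2, fun P' hP' hlt => ?_⟩, hQP⟩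
  by_contra! hcon
  exact hlt.not_subset (hP.2 (Finset.mem_filter.2 ⟨hP', hcon⟩) hlt.subset)

/-- By maximality the strictly larger set provided by `parent` has mean below `t`, and its measure
exceeds that of `Q` by a factor of at most `M`. The root is covered by `ht`. -/
lemma IsLaminarFamily.meanNorm_le_of_mem_stoppingSets (h : IsLaminarFamily 𝒟 Q₀ M) (hM : 1 ≤ M)
    {t : ℝ≥0∞} (ht : meanNorm f Q₀ ≤ t) {Q : Set X} (hQ : Q ∈ stoppingSets 𝒟 f t) :
    meanNorm f Q ≤ M * t := by
  rw [mem_stoppingSets] at hQ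
  by_cases hQ0 : Q = Q₀
  · rw [hQ0]
    exact ht.trans (le_mul_of_one_le_left' (by exact_mod_cast hM))
  · obtain ⟨P, hP, hQP, hvol⟩ := h.parent Q hQ.1 hQ0
    calc meanNorm f Q ≤ (∫⁻ x in P, ‖f x‖ₑ) / volume Q := by
          unfold meanNorm
          gcongr
      _ ≤ (∫⁻ x in P, ‖f x‖ₑ) * (M * (volume P)⁻¹) := by
          rw [div_eq_mul_inv]
          gcongr
          rw [ENNReal.inv_le_iff_inv_le, ENNReal.mul_inv (Or.inl (by simp; positivity))
            (Or.inl ENNReal.coe_ne_top), inv_inv, mul_comm, ← div_eq_mul_inv]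
          exact ENNReal.div_le_of_le_mul' hvol
      _ = M * meanNorm f P := by rw [meanNorm, div_eq_mul_inv]; ring
      _ ≤ M * t := by gcongr; exact (hQ.2.2 P hP hQP).le

lemma enorm_setAverage_le (f : X → ℂ) (Q : Set X) : ‖⨍ x in Q, f x‖ₑ ≤ meanNorm f Q := by
  rw [setAverage_eq, enorm_smul, meanNorm, div_eq_mul_inv, mul_comm]
  gcongr
  · exact enorm_integral_le_lintegral_enorm f
  · rw [measureReal_def, ← ENNReal.toReal_inv, Real.enorm_of_nonneg ENNReal.toReal_nonneg]
    exact ENNReal.ofReal_toReal_le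

/-- A set `Q` stopped at height `(M + 1) * t` lies in some `P` stopped at height `t`, where `|f_P| ≤
M * t`. Hence `∫_Q |f - f_P| ≥ (M + 1) t |Q| - M t |Q| = t |Q|`, and summing over the disjoint `Q`
inside `P` gives at most the oscillation on `P`. -/
lemma IsLaminarFamily.mul_volume_biUnion_stoppingSets_le (h : IsLaminarFamily 𝒟 Q₀ M) (hM : 1 ≤ M)
    (hf : IntegrableOn f Q₀) {t : ℝ≥0∞} (ht : meanNorm f Q₀ ≤ t) (httop : t ≠ ∞) :
    t * volume (⋃ Q ∈ stoppingSets 𝒟 f ((M + 1) * t), Q) ≤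
      ∑ P ∈ stoppingSets 𝒟 f t, osc f P := by
  classical
  have hex : ∀ Q ∈ stoppingSets 𝒟 f ((M + 1) * t), ∃ P ∈ stoppingSets 𝒟 f t, Q ⊆ P := by
    intro Q hQ
    rw [mem_stoppingSets] at hQ
    refine exists_mem_stoppingSets hQ.1 (le_trans ?_ hQ.2.1)
    exact le_mul_of_one_le_left' le_add_self
  choose! π hπ hπs using hex
  have hone : ∀ Q ∈ stoppingSets 𝒟 f ((M + 1) * t),
      t * volume Q ≤ ∫⁻ x in Q, ‖f x - ⨍ y in π Q, f y‖ₑ := by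
    intro Q hQ
    have hP := hπ Q hQ
    have hQ' := mem_stoppingSets.1 hQ
    have hvQ0 := h.volume_ne_zero Q hQ'.1
    have hvQt := h.volume_ne_top Q hQ'.1
    have hfQ : IntegrableOn f Q := hf.mono_set (h.subset_root Q hQ'.1)
    have h1 : (M + 1) * t * volume Q ≤ ∫⁻ x in Q, ‖f x‖ₑ :=
      ENNReal.mul_le_of_le_div hQ'.2.1
    have h2 : ∫⁻ x in Q, ‖f x‖ₑ ≤
        (∫⁻ x in Q, ‖f x - ⨍ y in π Q, f y‖ₑ) + M * t * volume Q := by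
      calc ∫⁻ x in Q, ‖f x‖ₑ
          ≤ ∫⁻ x in Q, (‖f x - ⨍ y in π Q, f y‖ₑ + M * t) := by
            refine lintegral_mono fun x => ?_
            calc ‖f x‖ₑ = ‖(f x - ⨍ y in π Q, f y) + ⨍ y in π Q, f y‖ₑ := by rw [sub_add_cancel]
              _ ≤ ‖f x - ⨍ y in π Q, f y‖ₑ + ‖⨍ y in π Q, f y‖ₑ := enorm_add_le _ _
              _ ≤ _ := by
                gcongr
                exact (enorm_setAverage_le f _).trans (h.meanNorm_le_of_mem_stoppingSets hM ht hP)
        _ = _ := by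
            rw [lintegral_add_right _ measurable_const, setLIntegral_const]
    have h3 : t * volume Q + M * t * volume Q ≤
        (∫⁻ x in Q, ‖f x - ⨍ y in π Q, f y‖ₑ) + M * t * volume Q := by
      refine le_trans (le_of_eq ?_) (h1.trans h2)
      ring
    exact (ENNReal.add_le_add_iff_right (by finiteness)).1 h3
  calc t * volume (⋃ Q ∈ stoppingSets 𝒟 f ((M + 1) * t), Q)
      ≤ t * ∑ Q ∈ stoppingSets 𝒟 f ((M + 1) * t), volume Q := by
        gcongr; exact measure_biUnion_finset_le _ _
    _ ≤ ∑ Q ∈ stoppingSets 𝒟 f ((M + 1) * t), ∫⁻ x in Q, ‖f x - ⨍ y in π Q, f y‖ₑ := by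
        rw [Finset.mul_sum]; exact Finset.sum_le_sum hone
    _ = ∑ P ∈ stoppingSets 𝒟 f t, ∑ Q ∈ stoppingSets 𝒟 f ((M + 1) * t) with π Q = P,
          ∫⁻ x in Q, ‖f x - ⨍ y in π Q, f y‖ₑ := (Finset.sum_fiberwise_of_maps_to hπ _).symm
    _ ≤ ∑ P ∈ stoppingSets 𝒟 f t, osc f P := by
        refine Finset.sum_le_sum fun P _ => ?_
        rw [Finset.sum_congr rfl (g := fun Q => ∫⁻ x in Q, ‖f x - ⨍ y in P, f y‖ₑ)
          fun Q hQ => by rw [(Finset.mem_filter.1 hQ).2]]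
        rw [← lintegral_biUnion_finset]
        · refine lintegral_mono_set (Set.iUnion₂_subset fun Q hQ => ?_)
          have := Finset.mem_filter.1 hQ
          rw [← this.2]
          exact hπs Q this.1
        · exact (h.pairwiseDisjoint_stoppingSets _).subset fun Q hQ =>
            (Finset.mem_filter.1 (Finset.mem_coe.1 hQ)).1
        · exact fun Q hQ => h.measurableSet Q (mem_stoppingSets.1 (Finset.mem_filter.1 hQ).1).1

lemma familyMaximal_le_sup (x : X) : familyMaximal 𝒟 f x ≤ 𝒟.sup (meanNorm f) :=
  Finset.sup_mono_fun fun _ _ => Set.indicator_le_self _ _ _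

lemma IsLaminarFamily.meanNorm_ne_top (h : IsLaminarFamily 𝒟 Q₀ M) (hf : IntegrableOn f Q₀)
    {Q : Set X} (hQ : Q ∈ 𝒟) : meanNorm f Q ≠ ∞ :=
  (ENNReal.div_lt_top (hf.mono_set (h.subset_root Q hQ)).2.ne (h.volume_ne_zero Q hQ)).ne

lemma IsLaminarFamily.sup_meanNorm_ne_top (h : IsLaminarFamily 𝒟 Q₀ M) (hf : IntegrableOn f Q₀) :
    𝒟.sup (meanNorm f) ≠ ∞ :=
  ((Finset.sup_lt_iff (by simp)).2 fun _ hQ => (h.meanNorm_ne_top hf hQ).lt_top).ne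

lemma le_familyMaximal {Q : Set X} (hQ : Q ∈ 𝒟) {x : X} (hx : x ∈ Q) :
    meanNorm f Q ≤ familyMaximal 𝒟 f x := by
  refine le_trans (le_of_eq ?_) (Finset.le_sup (f := fun Q => Q.indicator (fun _ => meanNorm f Q) x) hQ)
  rw [Set.indicator_of_mem hx]

lemma IsLaminarFamily.familyMaximal_eq_zero (h : IsLaminarFamily 𝒟 Q₀ M) {x : X} (hx : x ∉ Q₀) :
    familyMaximal 𝒟 f x = 0 := by
  refine (Finset.sup_eq_bot_iff _ _).2 fun Q hQ => ?_
  exact Set.indicator_of_notMem (fun hxQ => hx (h.subset_root Q hQ hxQ)) _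

lemma IsLaminarFamily.mem_biUnion_stoppingSets (h : IsLaminarFamily 𝒟 Q₀ M) {x : X} {t : ℝ≥0∞}
    (hx : x ∈ Q₀) (ht : t ≤ familyMaximal 𝒟 f x) : x ∈ ⋃ Q ∈ stoppingSets 𝒟 f t, Q := by
  rcases eq_or_ne t 0 with rfl | ht0
  · obtain ⟨P, hP, hsub⟩ := exists_mem_stoppingSets (f := f) h.root_mem zero_le
    exact Set.mem_biUnion hP (hsub hx)
  · obtain ⟨Q, hQ, hQe⟩ := Finset.exists_mem_eq_sup 𝒟 ⟨Q₀, h.root_mem⟩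
      (fun Q => Q.indicator (fun _ => meanNorm f Q) x)
    rw [familyMaximal, hQe] at ht
    by_cases hxQ : x ∈ Q
    · rw [Set.indicator_of_mem hxQ] at ht
      obtain ⟨P, hP, hsub⟩ := exists_mem_stoppingSets (f := f) hQ ht
      exact Set.mem_biUnion hP (hsub hxQ)
    · rw [Set.indicator_of_notMem hxQ] at ht
      exact absurd (le_antisymm ht zero_le) ht0

/-- Stopping sets of one height are disjoint, so at most one term survives, and its presence forces
the maximal function to reach `t`. -/
lemma IsLaminarFamily.sum_stoppingSets_indicator_le (h : IsLaminarFamily 𝒟 Q₀ M) (t w : ℝ≥0∞)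
    (x : X) : ∑ P ∈ stoppingSets 𝒟 f t, P.indicator (fun _ => w) x ≤
      if t ≤ familyMaximal 𝒟 f x then w else 0 := by
  by_cases hex : ∃ P ∈ stoppingSets 𝒟 f t, x ∈ P
  · obtain ⟨P, hP, hx⟩ := hex
    have hP' := mem_stoppingSets.1 hP
    rw [if_pos (hP'.2.1.trans (le_familyMaximal hP'.1 hx)), Finset.sum_eq_single_of_mem P hP]
    · exact Set.indicator_le_self _ _ _
    · intro Q hQ hne
      refine Set.indicator_of_notMem (fun hxQ => ?_) _
      exact Set.disjoint_left.1 (h.pairwiseDisjoint_stoppingSets t hQ hP hne) hxQ hx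
  · push Not at hex
    rw [Finset.sum_eq_zero fun P hP => Set.indicator_of_notMem (hex P hP) _]
    exact zero_le

/-- The powers of the levels below `F` form a geometric progression, dominated by its largest term,
which is at most `F ^ α`. -/
lemma sum_range_ite_rpow_le (a c : ℝ≥0) (hc : 1 ≤ c) (F : ℝ≥0∞) {α : ℝ} (hα : 0 < α) (K : ℕ) :
    ∑ k ∈ Finset.range K, (if ((a * c ^ k : ℝ≥0) : ℝ≥0∞) ≤ F then
      ((a * c ^ k : ℝ≥0) : ℝ≥0∞) ^ α else 0) ≤ (1 - ((c : ℝ≥0∞) ^ α)⁻¹)⁻¹ * F ^ α := by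
  induction K with
  | zero => simp
  | succ K ih =>
    by_cases hK : ((a * c ^ K : ℝ≥0) : ℝ≥0∞) ≤ F
    · have hc0 : (c : ℝ≥0∞) ≠ 0 := by
        have : c ≠ 0 := by positivity
        exact_mod_cast this
      have hD0 : (c : ℝ≥0∞) ^ α ≠ 0 := by simp [ENNReal.rpow_eq_zero_iff, hc0]
      have hDt : (c : ℝ≥0∞) ^ α ≠ ∞ := ENNReal.rpow_ne_top_of_nonneg hα.le ENNReal.coe_ne_top
      calc _ ≤ ∑ k ∈ Finset.range (K + 1), ((a * c ^ k : ℝ≥0) : ℝ≥0∞) ^ α := by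
            gcongr with k
            split_ifs
            · exact le_rfl
            · exact zero_le
        _ = ∑ k ∈ Finset.range (K + 1), ((a * c ^ (K - k) : ℝ≥0) : ℝ≥0∞) ^ α := by
            rw [← Finset.sum_range_reflect]
            refine Finset.sum_congr rfl fun k _ => ?_
            congr 4
        _ = ∑ k ∈ Finset.range (K + 1),
              ((a * c ^ K : ℝ≥0) : ℝ≥0∞) ^ α * (((c : ℝ≥0∞) ^ α)⁻¹) ^ k := by
            refine Finset.sum_congr rfl fun k hk => ?_
            have hkK : k ≤ K := Nat.lt_succ_iff.1 (Finset.mem_range.1 hk)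
            rw [← ENNReal.inv_pow, ← div_eq_mul_inv, ENNReal.eq_div_iff (pow_ne_zero _ hD0)
              (ENNReal.pow_ne_top hDt), mul_comm, ← ENNReal.rpow_natCast, ← ENNReal.rpow_mul,
              mul_comm α, ENNReal.rpow_mul, ENNReal.rpow_natCast,
              ← ENNReal.mul_rpow_of_nonneg _ _ hα.le]
            congr 1
            push_cast
            rw [mul_assoc, ← pow_add, Nat.sub_add_cancel hkK]
        _ ≤ ((a * c ^ K : ℝ≥0) : ℝ≥0∞) ^ α * (1 - ((c : ℝ≥0∞) ^ α)⁻¹)⁻¹ := by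
            rw [← Finset.mul_sum, ← ENNReal.tsum_geometric]
            gcongr
            exact ENNReal.sum_le_tsum _
        _ ≤ F ^ α * (1 - ((c : ℝ≥0∞) ^ α)⁻¹)⁻¹ := by gcongr
        _ = _ := mul_comm _ _
    · rw [Finset.sum_range_succ, if_neg hK, add_zero]
      exact ih

/-- The maximal function over a laminar family is controlled by a weighted sum of mean
oscillations over members of the family, the weights of which are controlled by the maximal
function itself. -/
theorem IsLaminarFamily.exists_lintegral_familyMaximal_le (h : IsLaminarFamily 𝒟 Q₀ M) (hM : 1 ≤ M)
    (hf : IntegrableOn f Q₀) (hmean : ∫ x in Q₀, f x = 0) (hne : meanNorm f Q₀ ≠ 0) {r : ℝ}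
    (hr : 1 < r) :
    ∃ (ι : Type) (_ : Fintype ι) (P : ι → Set X) (w : ι → ℝ≥0), (∀ i, P i ∈ 𝒟) ∧
      ∫⁻ x, familyMaximal 𝒟 f x ^ r ≤
        2 * ((M + 1 : ℝ≥0) : ℝ≥0∞) ^ (2 * r) * ∑ i, (w i : ℝ≥0∞) ^ (r - 1) * osc f (P i) ∧
      ∀ α : ℝ, 0 < α → ∀ x, ∑ i, (P i).indicator (fun _ => (w i : ℝ≥0∞) ^ α) x ≤
        (1 - (((M + 1 : ℝ≥0) : ℝ≥0∞) ^ α)⁻¹)⁻¹ * familyMaximal 𝒟 f x ^ α := by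
  classical
  obtain ⟨a, ha⟩ : ∃ a : ℝ≥0, (a : ℝ≥0∞) = meanNorm f Q₀ :=
    ⟨_, ENNReal.coe_toNNReal (h.meanNorm_ne_top hf h.root_mem)⟩
  have ha0 : 0 < a := by
    rw [← ha] at hne
    exact pos_iff_ne_zero.2 (by exact_mod_cast hne)
  set c : ℝ≥0 := M + 1 with hc
  have hc1 : 1 < c := by
    rw [hc]; exact lt_add_of_pos_left _ (lt_of_lt_of_le one_pos hM)
  -- Heights start at the mean over the root, where the first stopping set is the root itself, and
  -- grow by the ratio `M + 1` of the stopping estimate.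
  set T : ℕ → ℝ≥0 := fun k => a * c ^ k with hT
  have hTsucc : ∀ k, T (k + 1) = c * T k := fun k => by rw [hT]; ring
  have hTa : ∀ k, meanNorm f Q₀ ≤ T k := fun k => by
    rw [← ha, ENNReal.coe_le_coe]
    exact le_mul_of_one_le_right' (one_le_pow₀ hc1.le)
  have hr0 : 0 < r := by linarith
  -- the level beyond which there is nothing
  obtain ⟨K, hK0, hK⟩ : ∃ K, 0 < K ∧ ∀ x, familyMaximal 𝒟 f x < T K := by
    obtain ⟨B, hB⟩ : ∃ B : ℝ≥0, (B : ℝ≥0∞) = 𝒟.sup (meanNorm f) :=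
      ⟨_, ENNReal.coe_toNNReal (h.sup_meanNorm_ne_top hf)⟩
    obtain ⟨n, hn⟩ := pow_unbounded_of_one_lt (B / a) hc1
    refine ⟨n + 1, n.succ_pos, fun x => (familyMaximal_le_sup x).trans_lt ?_⟩
    rw [← hB, ENNReal.coe_lt_coe, hT]
    rw [div_lt_iff₀ ha0] at hn
    calc B < c ^ n * a := hn
      _ ≤ c ^ (n + 1) * a := by gcongr; exacts [hc1.le, n.le_succ]
      _ = _ := mul_comm _ _
  set G : ℕ → Set X := fun k => ⋃ Q ∈ stoppingSets 𝒟 f (T k), Q with hG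
  have hGm : ∀ k, MeasurableSet (G k) := fun k =>
    Finset.measurableSet_biUnion _ fun Q hQ => h.measurableSet Q (mem_stoppingSets.1 hQ).1
  -- On `Q₀` the value lies in some `[T k, T (k + 1))`, so `x` belongs to `G k`.
  have hpt : ∀ x, familyMaximal 𝒟 f x ^ r ≤
      ∑ k ∈ Finset.range K, (G k).indicator (fun _ => (T (k + 1) : ℝ≥0∞) ^ r) x := by
    intro x
    by_cases hx : x ∈ Q₀
    · have hexn : ∃ n, familyMaximal 𝒟 f x < T n := ⟨K, hK x⟩
      have hn1 := Nat.find_spec hexn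
      obtain ⟨k, hk⟩ : ∃ k, Nat.find hexn = k + 1 := by
        refine Nat.exists_eq_succ_of_ne_zero fun h0 => ?_
        rw [h0] at hn1
        refine absurd hn1 (not_lt.2 ?_)
        refine le_trans (le_of_eq ?_) (le_familyMaximal h.root_mem hx)
        rw [← ha, hT]; simp
      have hkK : k < K := by
        have := Nat.find_min' hexn (hK x)
        omega
      have hle : (T k : ℝ≥0∞) ≤ familyMaximal 𝒟 f x :=
        not_lt.1 (Nat.find_min hexn (by omega))
      rw [hk] at hn1
      calc familyMaximal 𝒟 f x ^ r ≤ (T (k + 1) : ℝ≥0∞) ^ r := by gcongr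
        _ = (G k).indicator (fun _ => (T (k + 1) : ℝ≥0∞) ^ r) x := by
            rw [Set.indicator_of_mem (h.mem_biUnion_stoppingSets hx hle)]
        _ ≤ _ := Finset.single_le_sum
            (f := fun k => (G k).indicator (fun _ => (T (k + 1) : ℝ≥0∞) ^ r) x)
            (fun _ _ => zero_le) (Finset.mem_range.2 hkK)
    · rw [h.familyMaximal_eq_zero hx, ENNReal.zero_rpow_of_pos hr0]
      exact zero_le
  set y : ℕ → ℝ≥0∞ := fun k => (T k : ℝ≥0∞) ^ (r - 1) * ∑ P ∈ stoppingSets 𝒟 f (T k), osc f P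
    with hy
  have hsplit : ∀ k, (T k : ℝ≥0∞) ^ r = (T k : ℝ≥0∞) ^ (r - 1) * T k := fun k => by
    nth_rewrite 3 [← ENNReal.rpow_one (T k : ℝ≥0∞)]
    rw [← ENNReal.rpow_add_of_nonneg _ _ (by linarith) zero_le_one]
    congr 1; ring
  have hc2 : (c : ℝ≥0∞) ^ r ≤ (c : ℝ≥0∞) ^ (2 * r) :=
    ENNReal.rpow_le_rpow_of_exponent_le (by exact_mod_cast hc1.le) (by linarith)
  -- The bottom level has no predecessor to be charged to. Here the mean-zero hypothesis enters: `T
  -- 0 * |Q₀|` is the oscillation of `f` on `Q₀`.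
  have hx0 : (T 1 : ℝ≥0∞) ^ r * volume (G 0) ≤ (c : ℝ≥0∞) ^ (2 * r) * y 0 := by
    have e0 : T 0 = a := by rw [hT]; simp
    have e1 : volume (G 0) ≤ volume Q₀ := measure_mono (Set.iUnion₂_subset fun Q hQ =>
      h.subset_root Q (mem_stoppingSets.1 hQ).1)
    have e2 : Q₀ ∈ stoppingSets 𝒟 f (T 0) := mem_stoppingSets.2
      ⟨h.root_mem, by rw [e0, ha], fun P hP hlt => absurd (h.subset_root P hP) hlt.not_subset⟩
    have e3 : (a : ℝ≥0∞) * volume Q₀ = osc f Q₀ := by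
      rw [ha, meanNorm, ENNReal.div_mul_cancel (h.volume_ne_zero _ h.root_mem)
        (h.volume_ne_top _ h.root_mem), osc, setAverage_eq, hmean]
      simp
    calc (T 1 : ℝ≥0∞) ^ r * volume (G 0) ≤ (T 1 : ℝ≥0∞) ^ r * volume Q₀ := by gcongr
      _ = (c : ℝ≥0∞) ^ r * ((T 0 : ℝ≥0∞) ^ (r - 1) * osc f Q₀) := by
          rw [hTsucc 0, ENNReal.coe_mul, ENNReal.mul_rpow_of_nonneg _ _ hr0.le, hsplit 0, ← e3, e0]
          ring
      _ ≤ (c : ℝ≥0∞) ^ (2 * r) * y 0 := by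
          refine mul_le_mul' hc2 (mul_le_mul' le_rfl ?_)
          exact Finset.single_le_sum (f := fun P => osc f P) (fun _ _ => zero_le) e2
  -- Level `k + 1` is charged to the oscillations at level `k`; the two steps from `T k` to `T (k +
  -- 2)` account for the exponent `2 * r`.
  have hxs : ∀ k, (T (k + 1 + 1) : ℝ≥0∞) ^ r * volume (G (k + 1)) ≤
      (c : ℝ≥0∞) ^ (2 * r) * y k := by
    intro k
    have e1 := h.mul_volume_biUnion_stoppingSets_le hM hf (hTa k) ENNReal.coe_ne_top
    have e2 : ((M : ℝ≥0∞) + 1) * (T k : ℝ≥0∞) = (T (k + 1) : ℝ≥0∞) := by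
      rw [hTsucc, hc]; push_cast; rfl
    rw [e2] at e1
    calc (T (k + 1 + 1) : ℝ≥0∞) ^ r * volume (G (k + 1))
        = (c : ℝ≥0∞) ^ (2 * r) * ((T k : ℝ≥0∞) ^ (r - 1) * (T k * volume (G (k + 1)))) := by
          rw [hTsucc, hTsucc, ENNReal.coe_mul, ENNReal.coe_mul,
            ENNReal.mul_rpow_of_nonneg _ _ hr0.le, ENNReal.mul_rpow_of_nonneg _ _ hr0.le, hsplit k,
            two_mul, ENNReal.rpow_add_of_nonneg _ _ hr0.le hr0.le]
          ring
      _ ≤ _ := mul_le_mul' le_rfl (mul_le_mul' le_rfl e1)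
  -- The factor `2` arises because `y 0` is charged both by level `0` and by level `1`.
  have hint : ∫⁻ x, familyMaximal 𝒟 f x ^ r ≤
      2 * (c : ℝ≥0∞) ^ (2 * r) * ∑ k ∈ Finset.range K, y k := by
    calc ∫⁻ x, familyMaximal 𝒟 f x ^ r
        ≤ ∑ k ∈ Finset.range K, (T (k + 1) : ℝ≥0∞) ^ r * volume (G k) := by
          refine (lintegral_mono hpt).trans (le_of_eq ?_)
          rw [lintegral_finsetSum _ fun k _ => measurable_const.indicator (hGm k)]
          refine Finset.sum_congr rfl fun k _ => ?_
          rw [lintegral_indicator (hGm k), setLIntegral_const]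
      _ ≤ ∑ k ∈ Finset.range (K + 1), (T (k + 1) : ℝ≥0∞) ^ r * volume (G k) :=
          Finset.sum_le_sum_of_subset (Finset.range_subset_range.2 K.le_succ)
      _ ≤ ∑ k ∈ Finset.range K, (c : ℝ≥0∞) ^ (2 * r) * y k + (c : ℝ≥0∞) ^ (2 * r) * y 0 := by
          rw [Finset.sum_range_succ']
          exact add_le_add (Finset.sum_le_sum fun k _ => hxs k) hx0
      _ ≤ (c : ℝ≥0∞) ^ (2 * r) * (∑ k ∈ Finset.range K, y k) +
          (c : ℝ≥0∞) ^ (2 * r) * ∑ k ∈ Finset.range K, y k := by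
          rw [Finset.mul_sum]
          gcongr
          rw [← Finset.mul_sum]
          gcongr
          exact Finset.single_le_sum (f := y) (fun _ _ => zero_le) (Finset.mem_range.2 hK0)
      _ = _ := by ring
  refine ⟨Σ k : Fin K, stoppingSets 𝒟 f (T k), inferInstance, fun i => i.2.1, fun i => T i.1,
    fun i => (mem_stoppingSets.1 i.2.2).1, hint.trans (le_of_eq ?_), fun α hα x => ?_⟩
  · rw [Fintype.sum_sigma, Finset.sum_range]
    congr 1
    refine Finset.sum_congr rfl fun k _ => ?_
    rw [hy]
    simp only
    rw [← Finset.mul_sum, Finset.sum_coe_sort (stoppingSets 𝒟 f (T k)) (fun P => osc f P)]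
  · rw [Fintype.sum_sigma]
    refine le_trans ?_ (sum_range_ite_rpow_le a c hc1.le (familyMaximal 𝒟 f x) hα K)
    rw [Finset.sum_range]
    refine Finset.sum_le_sum fun k _ => ?_
    simp only
    rw [Finset.sum_coe_sort (stoppingSets 𝒟 f (T k))
      (fun P => P.indicator (fun _ => (T k : ℝ≥0∞) ^ α) x)]
    exact h.sum_stoppingSets_indicator_le _ _ x

end Laminar

/-! ### Dyadic subcubes of a cube and Lebesgue differentiation along them. -/

section Dyadic

variable {d : ℕ}

/-- The dyadic subcube of generation `m` and position `k` of the cube with corner `u` and side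
length `ℓ`. -/
noncomputable def dyadicSubcube (u : EuclideanSpace ℝ (Fin d)) (ℓ : ℝ) (m : ℕ) (k : Fin d → ℕ) :
    Set (EuclideanSpace ℝ (Fin d)) :=
  cube (WithLp.toLp 2 fun j => u j + ℓ / 2 ^ m * k j) (ℓ / 2 ^ m)

lemma mem_dyadicSubcube {u : EuclideanSpace ℝ (Fin d)} {ℓ : ℝ} (hℓ : 0 < ℓ) {m : ℕ}
    {k : Fin d → ℕ} {x : EuclideanSpace ℝ (Fin d)} : x ∈ dyadicSubcube u ℓ m k ↔
      ∀ j, (k j : ℝ) ≤ 2 ^ m * ((x j - u j) / ℓ) ∧ 2 ^ m * ((x j - u j) / ℓ) < k j + 1 := by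
  refine forall_congr' fun j => and_congr ?_ ?_
  · have : 2 ^ m * ((x j - u j) / ℓ) = (x j - u j) / (ℓ / 2 ^ m) := by field_simp
    rw [this, le_div_iff₀ (by positivity)]
    constructor <;> intro h <;> linarith
  · have : 2 ^ m * ((x j - u j) / ℓ) = (x j - u j) / (ℓ / 2 ^ m) := by field_simp
    rw [this, div_lt_iff₀ (by positivity)]
    constructor <;> intro h <;> linarith

lemma dyadicSubcube_subset {u : EuclideanSpace ℝ (Fin d)} {ℓ : ℝ} (hℓ : 0 < ℓ) {m i : ℕ}
    {k k' : Fin d → ℕ} (h : ∀ j, k j * 2 ^ i ≤ k' j ∧ k' j + 1 ≤ (k j + 1) * 2 ^ i) :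
    dyadicSubcube u ℓ (m + i) k' ⊆ dyadicSubcube u ℓ m k := by
  intro x hx
  rw [mem_dyadicSubcube hℓ] at hx ⊢
  intro j
  obtain ⟨h1, h2⟩ := hx j
  obtain ⟨h3, h4⟩ := h j
  have h3' : (k j : ℝ) * 2 ^ i ≤ k' j := by exact_mod_cast h3
  have h4' : (k' j : ℝ) + 1 ≤ (k j + 1) * 2 ^ i := by exact_mod_cast h4
  have hi : (0 : ℝ) < 2 ^ i := by positivity
  rw [pow_add] at h1 h2
  constructor
  · by_contra! hcon
    nlinarith
  · by_contra! hcon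
    nlinarith

/-- A common point gives strict real inequalities between integer positions, which integrality
sharpens to nesting of the index intervals. -/
lemma dyadicSubcube_subset_of_inter {u : EuclideanSpace ℝ (Fin d)} {ℓ : ℝ} (hℓ : 0 < ℓ) {m i : ℕ}
    {k k' : Fin d → ℕ} {x : EuclideanSpace ℝ (Fin d)} (hx : x ∈ dyadicSubcube u ℓ m k)
    (hx' : x ∈ dyadicSubcube u ℓ (m + i) k') :
    dyadicSubcube u ℓ (m + i) k' ⊆ dyadicSubcube u ℓ m k := by
  refine dyadicSubcube_subset hℓ fun j => ?_
  rw [mem_dyadicSubcube hℓ] at hx hx'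
  obtain ⟨h1, h2⟩ := hx j
  obtain ⟨h3, h4⟩ := hx' j
  have hi : (0 : ℝ) < 2 ^ i := by positivity
  rw [pow_add] at h3 h4
  have e1 : (k j : ℝ) * 2 ^ i < k' j + 1 := by nlinarith
  have e2 : (k' j : ℝ) < (k j + 1) * 2 ^ i := by nlinarith
  exact ⟨Nat.lt_succ_iff.1 (by exact_mod_cast e1), Nat.succ_le_of_lt (by exact_mod_cast e2)⟩

open Classical in
/-- The dyadic subcubes of generation at most `n`. -/
noncomputable def dyadicFamily (u : EuclideanSpace ℝ (Fin d)) (ℓ : ℝ) (n : ℕ) :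
    Finset (Set (EuclideanSpace ℝ (Fin d))) :=
  (Finset.range (n + 1)).biUnion fun m =>
    (Finset.univ : Finset (Fin d → Fin (2 ^ m))).image fun k => dyadicSubcube u ℓ m fun j => k j

lemma mem_dyadicFamily {u : EuclideanSpace ℝ (Fin d)} {ℓ : ℝ} {n : ℕ}
    {Q : Set (EuclideanSpace ℝ (Fin d))} : Q ∈ dyadicFamily u ℓ n ↔
      ∃ m ≤ n, ∃ k : Fin d → ℕ, (∀ j, k j < 2 ^ m) ∧ Q = dyadicSubcube u ℓ m k := by
  classical
  simp only [dyadicFamily, Finset.mem_biUnion, Finset.mem_range, Finset.mem_image, Finset.mem_univ,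
    true_and, Nat.lt_succ_iff]
  constructor
  · rintro ⟨m, hm, k, rfl⟩
    exact ⟨m, hm, fun j => k j, fun j => (k j).2, rfl⟩
  · rintro ⟨m, hm, k, hk, rfl⟩
    exact ⟨m, hm, fun j => ⟨k j, hk j⟩, rfl⟩

lemma dyadicSubcube_zero (u : EuclideanSpace ℝ (Fin d)) (ℓ : ℝ) :
    dyadicSubcube u ℓ 0 (fun _ => 0) = cube u ℓ := by
  simp [dyadicSubcube]

lemma volume_dyadicSubcube (u : EuclideanSpace ℝ (Fin d)) (ℓ : ℝ) (m : ℕ) (k : Fin d → ℕ) :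
    volume (dyadicSubcube u ℓ m k) = ENNReal.ofReal (ℓ / 2 ^ m) ^ d :=
  volume_cube _ _

lemma isLaminarFamily_dyadicFamily (hd : 0 < d) (u : EuclideanSpace ℝ (Fin d)) {ℓ : ℝ} (hℓ : 0 < ℓ)
    (n : ℕ) : IsLaminarFamily (dyadicFamily u ℓ n) (cube u ℓ) (2 ^ d) where
  root_mem := mem_dyadicFamily.2 ⟨0, n.zero_le, fun _ => 0, fun _ => by simp,
    (dyadicSubcube_zero u ℓ).symm⟩
  subset_root Q hQ := by
    obtain ⟨m, -, k, hk, rfl⟩ := mem_dyadicFamily.1 hQ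
    rw [← dyadicSubcube_zero, ← Nat.zero_add m]
    exact dyadicSubcube_subset hℓ fun j => ⟨by simp, by simpa using hk j⟩
  measurableSet Q hQ := by
    obtain ⟨m, -, k, hk, rfl⟩ := mem_dyadicFamily.1 hQ
    exact measurableSet_cube _ _
  volume_ne_zero Q hQ := by
    obtain ⟨m, -, k, hk, rfl⟩ := mem_dyadicFamily.1 hQ
    exact volume_cube_ne_zero _ (by positivity)
  volume_ne_top Q hQ := by
    obtain ⟨m, -, k, hk, rfl⟩ := mem_dyadicFamily.1 hQ
    exact volume_cube_ne_top _ _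
  laminar Q hQ P hP := by
    obtain ⟨m, -, k, hk, rfl⟩ := mem_dyadicFamily.1 hQ
    obtain ⟨m', -, k', hk', rfl⟩ := mem_dyadicFamily.1 hP
    by_cases hdis : Disjoint (dyadicSubcube u ℓ m k) (dyadicSubcube u ℓ m' k')
    · exact Or.inl hdis
    · obtain ⟨x, hx, hx'⟩ := Set.not_disjoint_iff.1 hdis
      rcases le_total m m' with h | h
      · obtain ⟨i, rfl⟩ := Nat.exists_eq_add_of_le h
        exact Or.inr (Or.inr (dyadicSubcube_subset_of_inter hℓ hx hx'))
      · obtain ⟨i, rfl⟩ := Nat.exists_eq_add_of_le h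
        exact Or.inr (Or.inl (dyadicSubcube_subset_of_inter hℓ hx' hx))
  parent Q hQ hne := by
    obtain ⟨m, hm, k, hk, rfl⟩ := mem_dyadicFamily.1 hQ
    cases m with
    | zero =>
      refine absurd ?_ hne
      rw [← dyadicSubcube_zero]
      congr 1
      ext j
      have := hk j
      omega
    | succ m =>
      have hsub : dyadicSubcube u ℓ (m + 1) k ⊆ dyadicSubcube u ℓ m fun j => k j / 2 :=
        dyadicSubcube_subset hℓ fun j => by omega
      have hvol : volume (dyadicSubcube u ℓ m fun j => k j / 2) =
          2 ^ d * volume (dyadicSubcube u ℓ (m + 1) k) := by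
        rw [volume_dyadicSubcube, volume_dyadicSubcube, ← mul_pow, ← ENNReal.ofReal_ofNat,
          ← ENNReal.ofReal_mul (by norm_num)]
        congr 2
        rw [pow_succ]; field_simp
      refine ⟨_, mem_dyadicFamily.2 ⟨m, by omega, fun j => k j / 2, fun j => ?_, rfl⟩,
        hsub.ssubset_of_ne fun heq => ?_, ?_⟩
      · have := hk j
        rw [pow_succ] at this
        change k j / 2 < 2 ^ m
        omega
      -- Strictness is read off from volumes, and needs `d > 0`: in dimension zero all subcubes
      -- coincide.
      · have h1 := congrArg (fun S => volume S) heq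
        simp only [volume_dyadicSubcube] at h1
        have h2 : ENNReal.ofReal (ℓ / 2 ^ (m + 1)) ^ d < ENNReal.ofReal (ℓ / 2 ^ m) ^ d := by
          refine ENNReal.pow_lt_pow_left hd.ne' ?_
          rw [ENNReal.ofReal_lt_ofReal_iff (by positivity)]
          gcongr <;> simp
        exact h2.ne h1
      · rw [hvol]; simp

lemma exists_mem_dyadicFamily {u : EuclideanSpace ℝ (Fin d)} {ℓ : ℝ} (hℓ : 0 < ℓ) (n : ℕ)
    {x : EuclideanSpace ℝ (Fin d)} (hx : x ∈ cube u ℓ) :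
    ∃ w, cube w (ℓ / 2 ^ n) ∈ dyadicFamily u ℓ n ∧ x ∈ cube w (ℓ / 2 ^ n) := by
  have h0 : ∀ j, 0 ≤ (x j - u j) / ℓ := fun j => div_nonneg (by linarith [(hx j).1]) hℓ.le
  have h1 : ∀ j, (x j - u j) / ℓ < 1 := fun j => by
    rw [div_lt_one hℓ]; linarith [(hx j).2]
  set k : Fin d → ℕ := fun j => ⌊2 ^ n * ((x j - u j) / ℓ)⌋₊ with hk
  refine ⟨_, mem_dyadicFamily.2 ⟨n, le_rfl, k, fun j => ?_, rfl⟩, ?_⟩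
  · rw [hk, Nat.floor_lt (mul_nonneg (by positivity) (h0 j))]
    push_cast
    exact mul_lt_of_lt_one_right (by positivity) (h1 j)
  · refine (mem_dyadicSubcube hℓ).2 fun j => ⟨?_, ?_⟩
    · exact Nat.floor_le (mul_nonneg (by positivity) (h0 j))
    · exact Nat.lt_floor_add_one _

lemma exists_cube_of_mem_dyadicFamily {u : EuclideanSpace ℝ (Fin d)} {ℓ : ℝ} (hℓ : 0 < ℓ) {n : ℕ}
    {Q : Set (EuclideanSpace ℝ (Fin d))} (hQ : Q ∈ dyadicFamily u ℓ n) :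
    ∃ w l, 0 < l ∧ Q = cube w l := by
  obtain ⟨m, -, k, -, rfl⟩ := mem_dyadicFamily.1 hQ
  exact ⟨_, _, by positivity, rfl⟩

/-- Lebesgue differentiation: a locally integrable function is dominated almost everywhere by the
lower limit of its dyadic maximal functions. -/
lemma ae_enorm_rpow_le_liminf_familyMaximal (hd : 0 < d) {f : EuclideanSpace ℝ (Fin d) → ℂ}
    (hf : LocallyIntegrable f volume) (u : EuclideanSpace ℝ (Fin d)) {ℓ : ℝ} (hℓ : 0 < ℓ) {r : ℝ}
    (hr : 0 < r) :
    ∀ᵐ x, x ∈ cube u ℓ → ‖f x‖ₑ ^ r ≤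
      liminf (fun n => familyMaximal (dyadicFamily u ℓ n) f x ^ r) atTop := by
  have hd' : (0 : ℝ) < √d := Real.sqrt_pos.2 (by exact_mod_cast hd)
  filter_upwards [IsUnifLocDoublingMeasure.ae_tendsto_average_norm_sub volume hf 1] with x hx hxQ
  set ρ : ℕ → ℝ := fun n => √d * (ℓ / 2 ^ n) with hρ
  have hρ0 : ∀ n, 0 < ρ n := fun n => by rw [hρ]; positivity
  have hρlim : Tendsto ρ atTop (𝓝[>] 0) := by
    refine tendsto_nhdsWithin_iff.2 ⟨?_, Eventually.of_forall hρ0⟩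
    have h1 : Tendsto (fun n : ℕ => √d * ℓ * (1 / 2 : ℝ) ^ n) atTop (𝓝 (√d * ℓ * 0)) :=
      (tendsto_pow_atTop_nhds_zero_of_lt_one (by norm_num) (by norm_num)).const_mul _
    rw [mul_zero] at h1
    refine h1.congr fun n => ?_
    rw [hρ]
    simp only [one_div, inv_pow]
    ring
  have hT := hx (l := atTop) (fun _ => x) ρ hρlim (Eventually.of_forall fun n => by
    simp [(hρ0 n).le])
  -- The volume ratio between a ball of radius `√d * l` and a cube of side `l`. It transfers the
  -- Lebesgue-point property from centred balls to the dyadic cubes containing `x`.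
  set A : ℝ≥0∞ := ENNReal.ofReal √d ^ d *
    volume (Metric.closedBall (0 : EuclideanSpace ℝ (Fin d)) 1) with hA
  have hAtop : A ≠ ∞ := ENNReal.mul_ne_top (by finiteness) measure_closedBall_lt_top.ne
  set err : ℕ → ℝ≥0∞ := fun n => A * ((∫⁻ y in Metric.closedBall x (ρ n), ‖f y - f x‖ₑ) /
    volume (Metric.closedBall x (ρ n))) with herr
  have herrlim : Tendsto err atTop (𝓝 0) := by
    have h1 := (ENNReal.tendsto_ofReal hT)
    rw [ENNReal.ofReal_zero] at h1
    have h2 : Tendsto (fun n => A * ENNReal.ofReal (⨍ y in Metric.closedBall x (ρ n), ‖f y - f x‖))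
        atTop (𝓝 (A * 0)) := ENNReal.Tendsto.const_mul h1 (Or.inr hAtop)
    rw [mul_zero] at h2
    refine h2.congr fun n => ?_
    have hI : IntegrableOn (fun y => ‖f y - f x‖) (Metric.closedBall x (ρ n)) :=
      ((hf.integrableOn_isCompact (isCompact_closedBall _ _)).sub
        (integrableOn_const measure_closedBall_lt_top.ne)).norm
    rw [ofReal_setAverage hI (Eventually.of_forall fun _ => norm_nonneg _)]
    simp only [herr, ofReal_norm]
  have hle : ∀ n, ‖f x‖ₑ - err n ≤ familyMaximal (dyadicFamily u ℓ n) f x := by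
    intro n
    obtain ⟨w, hw, hxw⟩ := exists_mem_dyadicFamily hℓ n hxQ
    have hl : 0 < ℓ / 2 ^ n := by positivity
    have hsub : cube w (ℓ / 2 ^ n) ⊆ Metric.closedBall x (ρ n) := fun y hy => by
      rw [Metric.mem_closedBall, dist_eq_norm]
      exact norm_sub_le_of_mem_cube hy hxw hl.le
    have hv0 : volume (cube w (ℓ / 2 ^ n)) ≠ 0 := volume_cube_ne_zero _ hl
    have hvt : volume (cube w (ℓ / 2 ^ n)) ≠ ∞ := volume_cube_ne_top _ _
    have hvol : volume (Metric.closedBall x (ρ n)) = A * volume (cube w (ℓ / 2 ^ n)) := by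
      rw [Measure.addHaar_closedBall' _ _ (hρ0 n).le, finrank_euclideanSpace_fin, volume_cube, hA,
        ENNReal.ofReal_pow (hρ0 n).le, hρ, ENNReal.ofReal_mul hd'.le, mul_pow]
      ring
    have hA0 : A ≠ 0 := by
      intro h0
      rw [h0, zero_mul] at hvol
      exact (Metric.measure_closedBall_pos _ _ (hρ0 n)).ne' hvol
    refine le_trans ?_ (le_familyMaximal hw hxw)
    rw [tsub_le_iff_right]
    have h1 : ‖f x‖ₑ * volume (cube w (ℓ / 2 ^ n)) ≤ (∫⁻ y in cube w (ℓ / 2 ^ n), ‖f y‖ₑ) +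
        ∫⁻ y in Metric.closedBall x (ρ n), ‖f y - f x‖ₑ := by
      calc ‖f x‖ₑ * volume (cube w (ℓ / 2 ^ n)) = ∫⁻ _y in cube w (ℓ / 2 ^ n), ‖f x‖ₑ :=
            (setLIntegral_const _ _).symm
        _ ≤ ∫⁻ y in cube w (ℓ / 2 ^ n), (‖f y‖ₑ + ‖f y - f x‖ₑ) := by
            refine lintegral_mono fun y => ?_
            have := enorm_sub_le (a := f y) (b := f y - f x)
            rwa [sub_sub_cancel] at this
        _ = (∫⁻ y in cube w (ℓ / 2 ^ n), ‖f y‖ₑ) + ∫⁻ y in cube w (ℓ / 2 ^ n), ‖f y - f x‖ₑ :=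
            lintegral_add_left' (hf.aestronglyMeasurable.enorm.mono_measure
              Measure.restrict_le_self) _
        _ ≤ _ := by gcongr
    rw [← ENNReal.le_div_iff_mul_le (Or.inl hv0) (Or.inl hvt), ENNReal.add_div] at h1
    refine h1.trans (le_of_eq ?_)
    rw [meanNorm, herr]
    simp only
    rw [hvol, div_eq_mul_inv _ (A * _), ENNReal.mul_inv (Or.inl hA0) (Or.inl hAtop),
      mul_left_comm (∫⁻ y in Metric.closedBall x (ρ n), ‖f y - f x‖ₑ), ← mul_assoc A,
      ENNReal.mul_inv_cancel hA0 hAtop, one_mul, ← div_eq_mul_inv]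
  have hlim : Tendsto (fun n => (‖f x‖ₑ - err n) ^ r) atTop (𝓝 (‖f x‖ₑ ^ r)) := by
    have h1 := ENNReal.Tendsto.sub (tendsto_const_nhds (x := ‖f x‖ₑ)) herrlim
      (Or.inl enorm_ne_top)
    rw [tsub_zero] at h1
    exact (ENNReal.continuous_rpow_const.tendsto _).comp h1
  rw [← hlim.liminf_eq]
  refine liminf_le_liminf (Eventually.of_forall fun n => ?_)
  exact ENNReal.rpow_le_rpow (hle n) hr.le

end Dyadic

/-! ### The `L^r` estimate on cubes and the passage to the whole space. -/

section LocalToGlobal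

variable {d : ℕ}

lemma osc_sub_const {b : EuclideanSpace ℝ (Fin d) → ℂ} (c : ℂ) {Q : Set (EuclideanSpace ℝ (Fin d))}
    (hb : IntegrableOn b Q) (h0 : volume Q ≠ 0) (ht : volume Q ≠ ∞) :
    osc (fun x => b x - c) Q = osc b Q := by
  have hQ : volume.real Q ≠ 0 := by
    rw [measureReal_def]; exact (ENNReal.toReal_pos h0 ht).ne'
  have : ⨍ y in Q, (b y - c) = (⨍ y in Q, b y) - c := by
    rw [setAverage_eq, setAverage_eq, integral_sub hb (integrableOn_const ht), setIntegral_const,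
      smul_sub, smul_smul, inv_mul_cancel₀ hQ, one_smul]
  rw [osc, this, osc]
  simp only [sub_sub_sub_cancel_right]

/-- Local form of the main estimate: the `L^r` norm of the oscillation of `b` on a cube. -/
theorem HasPartnerCubes.exists_lintegral_sub_average_le (hd : 0 < d)
    {K : EuclideanSpace ℝ (Fin d) → EuclideanSpace ℝ (Fin d) → ℂ} (hK : HasPartnerCubes K)
    {p q r κ : ℝ} (hq : 1 < q) (hqp : q < p) (hr : r = p * q / (p - q)) (hκ : 0 < κ) :
    ∃ C : ℝ≥0, ∀ (b : EuclideanSpace ℝ (Fin d) → ℂ) (Θ : ℝ≥0), LocallyIntegrable b volume →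
      WeakCommutatorBound K b p q κ Θ → ∀ (u : EuclideanSpace ℝ (Fin d)) (ℓ : ℝ), 0 < ℓ →
      (∫⁻ x in cube u ℓ, ‖b x - ⨍ y in cube u ℓ, b y‖ₑ ^ r) ^ (1 / r) ≤ C * Θ := by
  have hp : 0 < p := by linarith
  have hpq : 0 < p - q := by linarith
  have hq1 : 0 < q - 1 := by linarith
  have hr1 : 1 < r := by
    rw [hr, one_lt_div hpq]; nlinarith
  have hr0 : 0 < r := by linarith
  set q' : ℝ := q / (q - 1) with hq'
  have hq'0 : 0 < q' := by positivity
  obtain ⟨C₁, hC₁⟩ := hK.exists_sum_osc_le hq hp hκ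
  set D : ℝ≥0∞ := ((2 ^ d + 1 : ℝ≥0) : ℝ≥0∞) with hD
  have hD1 : 1 < D := by
    rw [hD, ENNReal.one_lt_coe_iff]
    exact lt_add_of_pos_left _ (by positivity)
  set G : ℝ → ℝ≥0∞ := fun α => (1 - (D ^ α)⁻¹)⁻¹ with hG
  have hGtop : ∀ α, 0 < α → G α ≠ ∞ := by
    intro α hα
    have h1 : 1 < D ^ α := ENNReal.one_lt_rpow hD1 hα
    have h2 : (D ^ α)⁻¹ < 1 := ENNReal.inv_lt_one.2 h1
    rw [hG]
    simp only [ne_eq, ENNReal.inv_eq_top]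
    exact (tsub_pos_of_lt h2).ne'
  -- `D` is the level ratio for dyadic cubes (`M = 2 ^ d`), and `G α` is the geometric-series
  -- constant for weights of power `α`.
  set C : ℝ≥0∞ := 2 * D ^ (2 * r) * C₁ * G (r / p) * G (r / q') with hC
  have hCtop : C ≠ ∞ := by
    have h1 := hGtop (r / p) (by positivity)
    have h2 := hGtop (r / q') (by positivity)
    have h3 : D ^ (2 * r) ≠ ∞ := ENNReal.rpow_ne_top_of_nonneg (by positivity) ENNReal.coe_ne_top
    rw [hC]
    finiteness
  refine ⟨C.toNNReal, fun b Θ hb hW u ℓ hℓ => ?_⟩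
  rw [ENNReal.coe_toNNReal hCtop]
  set c := ⨍ y in cube u ℓ, b y with hc
  set f : EuclideanSpace ℝ (Fin d) → ℂ := fun x => b x - c with hf
  have hbI : ∀ w l, 0 < l → IntegrableOn b (cube w l) := fun w l hl =>
    (hb.integrableOn_isCompact (isCompact_closedBall w (√d * l))).mono_set
      (cube_subset_closedBall w hl)
  have hfl : LocallyIntegrable f volume := hb.sub (locallyIntegrable_const c)
  have hfI : IntegrableOn f (cube u ℓ) :=
    (hbI u ℓ hℓ).sub (integrableOn_const (volume_cube_ne_top _ _))
  have hmean : ∫ x in cube u ℓ, f x = 0 := by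
    have hv : volume.real (cube u ℓ) ≠ 0 := by
      rw [measureReal_def]
      exact (ENNReal.toReal_pos (volume_cube_ne_zero u hℓ) (volume_cube_ne_top u ℓ)).ne'
    rw [hf, integral_sub (hbI u ℓ hℓ) (integrableOn_const (volume_cube_ne_top _ _)),
      setIntegral_const, hc, setAverage_eq, smul_smul, mul_inv_cancel₀ hv, one_smul, sub_self]
  -- The stopping heights start at this mean, so the trivial case where it vanishes is set aside.
  by_cases hne : meanNorm f (cube u ℓ) = 0
  · have h0 : ∫⁻ x in cube u ℓ, ‖f x‖ₑ = 0 := by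
      rcases ENNReal.div_eq_zero_iff.1 hne with h | h
      · exact h
      · exact absurd h (volume_cube_ne_top _ _)
    rw [lintegral_eq_zero_iff' hfI.aestronglyMeasurable.enorm] at h0
    have h1 : ∫⁻ x in cube u ℓ, ‖f x‖ₑ ^ r = 0 := by
      refine (lintegral_congr_ae (g := fun _ => 0) ?_).trans lintegral_zero
      filter_upwards [h0] with x hx
      rw [hx]
      simp [hr0]
    rw [h1, ENNReal.zero_rpow_of_pos (by positivity)]
    exact zero_le
  -- The only place where the exact value of `r` matters: `w ^ (r - 1)` splits into weights suited
  -- to the `L^p` and `L^{q'}` norms.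
  have hexp : r / p + r / q' = r - 1 := by
    rw [hq', hr]; field_simp; ring
  have hn : ∀ n, (∫⁻ x, familyMaximal (dyadicFamily u ℓ n) f x ^ r) ^ (1 / r) ≤ C * Θ := by
    intro n
    have hL := isLaminarFamily_dyadicFamily hd u hℓ n
    obtain ⟨ι, hι, P, w, hP, hX, hα⟩ := hL.exists_lintegral_familyMaximal_le
      (one_le_pow₀ one_le_two) hfI hmean hne hr1
    choose v l hl hPv using fun i => exists_cube_of_mem_dyadicFamily hℓ (hP i)
    set F := familyMaximal (dyadicFamily u ℓ n) f with hF
    set Y := ∫⁻ x, F x ^ r with hY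
    have hYtop : Y ≠ ∞ := by
      set B := (dyadicFamily u ℓ n).sup (meanNorm f) with hB
      have hBt : B ≠ ∞ := hL.sup_meanNorm_ne_top hfI
      have h1 : Y ≤ ∫⁻ x, (cube u ℓ).indicator (fun _ => B ^ r) x := by
        refine lintegral_mono fun x => ?_
        by_cases hx : x ∈ cube u ℓ
        · rw [Set.indicator_of_mem hx]
          exact ENNReal.rpow_le_rpow (familyMaximal_le_sup x) hr0.le
        · rw [hF, hL.familyMaximal_eq_zero hx, ENNReal.zero_rpow_of_pos hr0]
          exact zero_le
      refine ne_top_of_le_ne_top ?_ h1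
      rw [lintegral_indicator (measurableSet_cube _ _), setLIntegral_const]
      exact ENNReal.mul_ne_top (ENNReal.rpow_ne_top_of_nonneg hr0.le hBt) (volume_cube_ne_top _ _)
    have hS := hC₁ b Θ hb hW ι v l (fun i => w i ^ (r / p)) (fun i => w i ^ (r / q')) hl
    have hosc : ∑ i, (w i : ℝ≥0∞) ^ (r - 1) * osc f (P i) = ∑ i, ((w i ^ (r / p) : ℝ≥0) : ℝ≥0∞) *
        ((w i ^ (r / q') : ℝ≥0) : ℝ≥0∞) * osc b (cube (v i) (l i)) := by
      refine Finset.sum_congr rfl fun i _ => ?_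
      rw [← hexp, ENNReal.rpow_add_of_nonneg _ _ (by positivity) (by positivity),
        ENNReal.coe_rpow_of_nonneg _ (by positivity), ENNReal.coe_rpow_of_nonneg _ (by positivity),
        hPv i, hf, osc_sub_const c (hbI _ _ (hl i)) (volume_cube_ne_zero _ (hl i))
        (volume_cube_ne_top _ _)]
    have hfac : ∀ s : ℝ, 0 < s →
        (∫⁻ x, (∑ i, (cube (v i) (l i)).indicator
          (fun _ => ((w i ^ (r / s) : ℝ≥0) : ℝ≥0∞)) x) ^ s) ^ (1 / s) ≤
        G (r / s) * Y ^ (1 / s) := by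
      intro s hs
      have hpos : 0 < r / s := by positivity
      calc _ ≤ (∫⁻ x, (G (r / s) * F x ^ (r / s)) ^ s) ^ (1 / s) := by
            refine ENNReal.rpow_le_rpow (lintegral_mono fun x => ?_) (by positivity)
            refine ENNReal.rpow_le_rpow ?_ hs.le
            refine le_trans (le_of_eq ?_) (hα (r / s) hpos x)
            refine Finset.sum_congr rfl fun i _ => ?_
            rw [hPv i, ENNReal.coe_rpow_of_nonneg _ hpos.le]
        _ = (G (r / s) ^ s * Y) ^ (1 / s) := by
            rw [hY, ← lintegral_const_mul' _ _ (ENNReal.rpow_ne_top_of_nonneg hs.le (hGtop _ hpos))]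
            congr 2
            ext x
            rw [ENNReal.mul_rpow_of_nonneg _ _ hs.le, ← ENNReal.rpow_mul, div_mul_cancel₀ _ hs.ne']
        _ = _ := by
            rw [ENNReal.mul_rpow_of_nonneg _ _ (by positivity), ← ENNReal.rpow_mul,
              mul_one_div_cancel hs.ne', ENNReal.rpow_one]
    -- Both weight norms are powers of the same `Y`, with total exponent `1 / p + 1 / q' = 1 - 1 /
    -- r`.
    have hfin : Y ≤ C * Θ * Y ^ (1 / (r / (r - 1))) := by
      calc Y ≤ 2 * D ^ (2 * r) * ∑ i, (w i : ℝ≥0∞) ^ (r - 1) * osc f (P i) := hX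
        _ ≤ 2 * D ^ (2 * r) * (C₁ * Θ * (G (r / p) * Y ^ (1 / p)) * (G (r / q') * Y ^ (1 / q'))) := by
            rw [hosc]
            gcongr
            refine hS.trans ?_
            gcongr
            · exact hfac p hp
            · exact hfac q' hq'0
        _ = C * Θ * Y ^ (1 / (r / (r - 1))) := by
            have h1 : 1 / (r / (r - 1)) = 1 / p + 1 / q' := by
              rw [one_div_div, ← hexp]; field_simp
            rw [h1, ENNReal.rpow_add_of_nonneg _ _ (by positivity) (by positivity), hC]
            ring
    refine rpow_inv_le_of_le_mul_rpow hr0 ?_ hYtop hfin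
    field_simp
    ring
  have hleb := ae_enorm_rpow_le_liminf_familyMaximal hd hfl u hℓ hr0
  have hFm : ∀ n, Measurable (fun x => familyMaximal (dyadicFamily u ℓ n) f x ^ r) := by
    intro n
    refine Measurable.pow_const ?_ _
    have hL := isLaminarFamily_dyadicFamily hd u hℓ n
    unfold familyMaximal
    simp_rw [Finset.sup_eq_iSup]
    exact Measurable.biSup _ (Finset.countable_toSet _) fun Q hQ =>
      measurable_const.indicator (hL.measurableSet Q hQ)
  have hrr : ∀ z : ℝ≥0∞, z ^ (1 / r) ≤ C * Θ ↔ z ≤ (C * Θ) ^ r := fun z => by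
    rw [one_div, ENNReal.rpow_inv_le_iff hr0]
  rw [hrr]
  -- The bound on the maximal functions does not depend on the number of generations, so Fatou
  -- applies.
  calc ∫⁻ x in cube u ℓ, ‖f x‖ₑ ^ r
      ≤ ∫⁻ x in cube u ℓ, liminf (fun n => familyMaximal (dyadicFamily u ℓ n) f x ^ r) atTop := by
        exact lintegral_mono_ae ((ae_restrict_iff' (measurableSet_cube u ℓ)).2 hleb)
    _ ≤ ∫⁻ x, liminf (fun n => familyMaximal (dyadicFamily u ℓ n) f x ^ r) atTop :=
        setLIntegral_le_lintegral _ _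
    _ ≤ liminf (fun n => ∫⁻ x, familyMaximal (dyadicFamily u ℓ n) f x ^ r) atTop :=
        lintegral_liminf_le hFm
    _ ≤ (C * Θ) ^ r := by
        refine (liminf_le_liminf (v := fun _ => (C * Θ) ^ r)
          (Eventually.of_forall fun n => (hrr _).1 (hn n))).trans (le_of_eq ?_)
        simp

/-- Uniform `L^r` control of the oscillation on all cubes gives global `L^r` control modulo
constants. -/
theorem exists_eLpNorm_sub_const_le {r : ℝ} (hr : 1 ≤ r) {b : EuclideanSpace ℝ (Fin d) → ℂ}
    (hb : LocallyIntegrable b volume) {C : ℝ≥0}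
    (h : ∀ (u : EuclideanSpace ℝ (Fin d)) (ℓ : ℝ), 0 < ℓ →
      (∫⁻ x in cube u ℓ, ‖b x - ⨍ y in cube u ℓ, b y‖ₑ ^ r) ^ (1 / r) ≤ C) :
    ∃ c : ℂ, eLpNorm (fun x => b x - c) (ENNReal.ofReal r) volume ≤ C := by
  have hr0 : 0 < r := by linarith
  have hrE : ENNReal.ofReal r ≠ 0 := by simpa using hr0
  set Q : ℕ → Set (EuclideanSpace ℝ (Fin d)) := fun m =>
    cube (WithLp.toLp 2 fun _ => -((m : ℝ) + 1)) (2 * ((m : ℝ) + 1)) with hQ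
  set c : ℕ → ℂ := fun m => ⨍ y in Q m, b y with hc
  have hbm : AEStronglyMeasurable b volume := hb.aestronglyMeasurable
  have hnorm : ∀ m, eLpNorm (fun x => b x - c m) (ENNReal.ofReal r) (volume.restrict (Q m)) ≤ C := by
    intro m
    rw [eLpNorm_eq_lintegral_rpow_enorm_toReal hrE ENNReal.ofReal_ne_top,
      ENNReal.toReal_ofReal hr0.le]
    exact h _ _ (by positivity)
  have hmem : ∀ (m : ℕ) x, x ∈ Q m ↔ ∀ j, -((m : ℝ) + 1) ≤ x j ∧ x j < (m : ℝ) + 1 := by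
    intro m x
    refine forall_congr' fun j => and_congr Iff.rfl ?_
    simp only
    constructor <;> intro h <;> linarith
  have hmono : ∀ m n, m ≤ n → Q m ⊆ Q n := by
    intro m n hmn x hx
    rw [hmem] at hx ⊢
    intro j
    have : (m : ℝ) ≤ n := by exact_mod_cast hmn
    constructor <;> linarith [(hx j).1, (hx j).2]
  have hv0 : volume (Q 0) ≠ 0 := volume_cube_ne_zero _ (by positivity)
  have hvt : volume (Q 0) ≠ ∞ := volume_cube_ne_top _ _
  -- On `Q 0` both `b - c 0` and `b - c m` have `L^r` norm at most `C`, so their constant difference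
  -- is bounded uniformly in `m`.
  have hbdd : ∀ m, ‖c m - c 0‖ₑ ≤ 2 * C / volume (Q 0) ^ (1 / r) := by
    intro m
    have h1 : eLpNorm (fun _ : EuclideanSpace ℝ (Fin d) => c m - c 0) (ENNReal.ofReal r)
        (volume.restrict (Q 0)) ≤ 2 * C := by
      have e1 : (fun _ : EuclideanSpace ℝ (Fin d) => c m - c 0) =
          (fun x => b x - c 0) - (fun x => b x - c m) := by
        ext x; simp
      rw [e1, two_mul]
      refine (eLpNorm_sub_le (hbm.restrict.sub aestronglyMeasurable_const)
        (hbm.restrict.sub aestronglyMeasurable_const) (by simpa using hr)).trans ?_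
      exact add_le_add (hnorm 0) ((eLpNorm_mono_measure _
        (Measure.restrict_mono (hmono 0 m m.zero_le) le_rfl)).trans (hnorm m))
    rw [eLpNorm_const' _ hrE ENNReal.ofReal_ne_top, Measure.restrict_apply_univ,
      ENNReal.toReal_ofReal hr0.le] at h1
    rwa [ENNReal.le_div_iff_mul_le (Or.inl (by simp [ENNReal.rpow_eq_zero_iff, hv0, hvt]))
      (Or.inl (ENNReal.rpow_ne_top_of_nonneg (by positivity) hvt))]
  have hBtop : 2 * (C : ℝ≥0∞) / volume (Q 0) ^ (1 / r) ≠ ∞ :=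
    ENNReal.div_ne_top (by finiteness) (by simp [ENNReal.rpow_eq_zero_iff, hv0, hvt])
  have hball : ∀ m, c m ∈ Metric.closedBall (c 0) (2 * (C : ℝ≥0∞) / volume (Q 0) ^ (1 / r)).toReal := by
    intro m
    rw [Metric.mem_closedBall, dist_eq_norm, ← toReal_enorm]
    exact ENNReal.toReal_mono hBtop (hbdd m)
  obtain ⟨c', -, φ, hφ, hlim⟩ := tendsto_subseq_of_bounded Metric.isBounded_closedBall hball
  refine ⟨c', ?_⟩
  -- Along a subsequence the averages converge and the cubes exhaust the space, so the truncations
  -- `1_{Q} (b - c)` converge pointwise to `b - c'`; Fatou keeps the bound `C`.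
  have hF := Lp.eLpNorm_lim_le_liminf_eLpNorm (p := ENNReal.ofReal r) (μ := volume)
    (f := fun n => (Q (φ n)).indicator fun x => b x - c (φ n))
    (fun n => (hbm.sub aestronglyMeasurable_const).indicator (measurableSet_cube _ _))
    (fun x => b x - c') (Eventually.of_forall fun x => ?_)
  · refine hF.trans ?_
    refine (liminf_le_liminf (v := fun _ => (C : ℝ≥0∞)) (Eventually.of_forall fun n => ?_)).trans
      (le_of_eq (by simp))
    rw [eLpNorm_indicator_eq_eLpNorm_restrict (measurableSet_cube _ _)]
    exact hnorm _
  · have h1 : Tendsto (fun n => b x - c (φ n)) atTop (𝓝 (b x - c')) := hlim.const_sub _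
    refine h1.congr' ?_
    obtain ⟨M, hM⟩ := exists_nat_gt ‖x‖
    filter_upwards [eventually_ge_atTop M] with n hn
    rw [Set.indicator_of_mem]
    rw [hmem]
    intro j
    have h2 : |x j| ≤ ‖x‖ := PiLp.norm_apply_le x j
    have h3 : (M : ℝ) ≤ φ n := by exact_mod_cast hn.trans hφ.le_apply
    rw [abs_le] at h2
    constructor <;> linarith

end LocalToGlobal

end CommutatorLpLq

theorem theorem2p7 {d : ℕ} (hd : 0 < d)
    (K : EuclideanSpace ℝ (Fin d) → EuclideanSpace ℝ (Fin d) → ℂ)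
    (hK : CommutatorLpLq.IsNondegenerateCZKernel K)
    (p q r : ℝ) (hq : 1 < q) (hqp : q < p) (hr : r = p * q / (p - q))
    (κ : ℝ) (hκ : 0 < κ) :
    ∃ C : ℝ≥0, ∀ (b : EuclideanSpace ℝ (Fin d) → ℂ) (Θ : ℝ≥0),
      LocallyIntegrable b volume →
      CommutatorLpLq.WeakCommutatorBound K b p q κ Θ →
      ∃ (a : EuclideanSpace ℝ (Fin d) → ℂ) (c : ℂ),
        MemLp a (ENNReal.ofReal r) volume ∧
        (∀ᵐ x, b x = a x + c) ∧
        eLpNorm a (ENNReal.ofReal r) volume ≤ (C : ℝ≥0∞) * (Θ : ℝ≥0∞) := by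
  obtain ⟨C, hC⟩ := (hK.hasPartnerCubes hd).exists_lintegral_sub_average_le hd hq hqp hr hκ
  have hr1 : 1 ≤ r := by
    rw [hr, one_le_div (by linarith)]; nlinarith
  refine ⟨C, fun b Θ hb hW => ?_⟩
  obtain ⟨c, hc⟩ := CommutatorLpLq.exists_eLpNorm_sub_const_le hr1 hb (C := C * Θ)
    fun u ℓ hℓ => by
      rw [ENNReal.coe_mul]; exact hC b Θ hb hW u ℓ hℓ
  rw [ENNReal.coe_mul] at hc
  exact ⟨fun x => b x - c, c, ⟨hb.aestronglyMeasurable.sub aestronglyMeasurable_const,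
    hc.trans_lt (ENNReal.mul_lt_top ENNReal.coe_lt_top ENNReal.coe_lt_top)⟩,
    Eventually.of_forall fun x => (sub_add_cancel _ _).symm, hc⟩
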